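/- **Standing notions.** Let $(X_1,d_1,\nu_1)$ be a complete, path-connected metric space with a Borel measure, let $X_2$ be a complete metric space, and let $\Omega\subsetneq X_1$ be a bounded domain (nonempty, open, connected). Let $q>1$. $\Omega$ is *Ahlfors $q$-regular* with constant $C_q\ge 1$ if $C_q^{-1}r^q\le \nu_1(B(x,r)\cap\Omega)\le C_q r^q$ for all $x\in\Omega$, $0<r<\operatorname{diam}\Omega$. Write $\ell$ for length. * $\Omega$ is *uniform* with constant $A>0$ if any $x_1,x_2\in\Omega$ are joined by a curve $\gamma:[0,1]\to\Omega$ with $\ell(\gamma)\le A\,d_1(x_1,x_2)$ and $\min\{\ell(\gamma|_{[0,t]}),\ell(\gamma|_{[t,1]})\}\le A\,d_1(\gamma(t),\partial\Omega)$ for all $t\in[0,1]$. It is *$c$-John with center $x_0\in\Omega$* ($c\ge1$) if every $x\in\Omega$ is joined to $x_0$ by a curve $\gamma:[0,1]\to\Omega$, $\gamma(0)=x$, $\gamma(1)=x_0$, with $\ell(\gamma|_{[0,t]})\le c\,d_1(\gamma(t),\partial\Omega)$ for all $t\in[0,1]$. It is *$c$-uniform with center $x_0$* if it is uniform (with some constant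 $A$) and $c$-John with center $x_0$. * For $\omega\in\partial\Omega$, $I^c(\omega,x_0)$ is the set of continuous $\gamma:(0,1]\to\Omega$ with $\gamma(1)=x_0$, $\lim_{t\to0^+}\gamma(t)=\omega$ and $\ell(\gamma|_{(0,t]})\le c\,d_1(\gamma(t),\partial\Omega)$ for all $t\in(0,1]$. * For $\sigma\ge1$, a map $f:\Omega\to X_2$ (not assumed continuous) belongs to $\mathcal A_2(\sigma)$ if there are $0\le\alpha\in L^1(\Omega)$ and $C\ge1$ such that $$\operatorname{diam} f(B)\le C\Big(\int_{\sigma B}\alpha\,d\nu_1\Big)^{1/q}\Big(\log\frac1{\operatorname{diam}B}\Big)^{1/q}$$ for every ball $B=B(x,r)$, $x\in\Omega$, $r>0$, such that $\sigma B=B(x,\sigma r)$ has compact closure contained in $\Omega$ and $\operatorname{diam}B<1$. * A *doubling gauge* is a continuous nondecreasing $h:[0,\infty)\to[0,\infty)$ with $h(0)=0$ and $h(2t)\le Dh(t)$ for some constant $D$ and all $t>0$; $\mathcal H^h(E)=\lim_{r\to0}\inf\{\sum_i h(\operatorname{diam}E_i): E\subset\bigcup_{i\in\mathbb N}E_i,\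 \operatorname{diam}E_i\le r\}$. **Theorem.** Let $q>1$ and constants $C_q,c\ge 1$, $A>0$, $M\ge1$ be given. There is $\sigma\ge1$, depending only on $q,C_q,c,A,M$, with the following property. Let $X_1,X_2,\nu_1$ be as above, and let $\Omega\subsetneq X_1$ be a bounded domain that is Ahlfors $q$-regular with constant $C_q$, uniform with constant $A$, and $c$-John with center $x_0$, and such that $d_1(x,\partial\Omega)\le M\,d_1(x,X_1\setminus\Omega)$ for all $x\in\Omega$ (this holds with $M=1$ whenever $X_1$ is a length space). Let $h$ be a doubling gauge with $$\int_0^1\Big[h(t)\log\frac1t\Big]^{\frac1{q-1}}\frac{dt}{t}<\infty,$$ and let $f\in\mathcal A_2(\sigma)$. Then for $\mathcal H^h$-almost every $\omega\in\partial\Omega$ (i.e. outside a subset of $\partial\Omega$ of $\mathcal H^h$-measure zero): the limit $\lim_{t\to0^+}f(\gamma(t))$ exists in $X_2$ for every $\gamma\in I^c(\omega,x_0)$, and if $\gamma,\eta\in I^c(\omega,x_0)$ satisfy $\lim_{t\to0^+}f(\gamma(t))=a$ and $\lim_{t\to0^+}f(\eta(t))=b$, then $a=b$. -/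

import Mathlib

open Set Filter Topology MeasureTheory

universe u v

noncomputable section

namespace JohnLimits

/-- The length of the curve `γ` restricted to the parameter set `I`
(the supremum of the sums of distances over finite partitions). -/
abbrev curveLength {X : Type*} [MetricSpace X] (γ : ℝ → X) (I : Set ℝ) : ENNReal :=
  eVariationOn γ I

/-- A bounded domain: a nonempty, open, connected and bounded set. -/
structure IsBoundedDomain {X : Type*} [MetricSpace X] (Ω : Set X) : Prop where
  isOpen : IsOpen Ω
  isConnected : IsConnected Ω
  isBounded : Bornology.IsBounded Ω

/-- Ahlfors `q`-regularity of `Ω` with constant `K`: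
`r ^ q / K ≤ ν (B(x, r) ∩ Ω) ≤ K r ^ q` for all `x ∈ Ω` and `0 < r < diam Ω`
(here `Ω` is bounded, so that `Metric.diam` is the true diameter). -/
def IsAhlforsRegular {X : Type*} [MetricSpace X] [MeasurableSpace X]
    (ν : Measure X) (q K : ℝ) (Ω : Set X) : Prop :=
  ∀ x ∈ Ω, ∀ r : ℝ, 0 < r → r < Metric.diam Ω →
    ENNReal.ofReal (r ^ q / K) ≤ ν (Metric.ball x r ∩ Ω) ∧
      ν (Metric.ball x r ∩ Ω) ≤ ENNReal.ofReal (K * r ^ q)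

/-- `Ω` is a `c`-John domain with center `x₀`: every `x ∈ Ω` is joined to `x₀` by a curve
`γ : [0,1] → Ω` with `ℓ(γ|[0,t]) ≤ c d(γ(t), ∂Ω)` for all `t`. -/
def IsJohnDomain {X : Type*} [MetricSpace X] (c : ℝ) (Ω : Set X) (x₀ : X) : Prop :=
  x₀ ∈ Ω ∧ ∀ x ∈ Ω, ∃ γ : ℝ → X,
    ContinuousOn γ (Icc 0 1) ∧ MapsTo γ (Icc 0 1) Ω ∧ γ 0 = x ∧ γ 1 = x₀ ∧
      ∀ t ∈ Icc (0 : ℝ) 1,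
        curveLength γ (Icc 0 t) ≤ ENNReal.ofReal (c * Metric.infDist (γ t) (frontier Ω))

/-- `Ω` is a uniform domain with constant `A`: any `x₁, x₂ ∈ Ω` are joined by a curve in `Ω` of
length at most `A d(x₁, x₂)` such that at each of its points the shorter of the two subcurves
has length at most `A` times the distance of that point to `∂Ω`. -/
def IsUniformDomain {X : Type*} [MetricSpace X] (A : ℝ) (Ω : Set X) : Prop :=
  ∀ x₁ ∈ Ω, ∀ x₂ ∈ Ω, ∃ γ : ℝ → X,
    ContinuousOn γ (Icc 0 1) ∧ MapsTo γ (Icc 0 1) Ω ∧ γ 0 = x₁ ∧ γ 1 = x₂ ∧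
      curveLength γ (Icc 0 1) ≤ ENNReal.ofReal (A * dist x₁ x₂) ∧
      ∀ t ∈ Icc (0 : ℝ) 1,
        min (curveLength γ (Icc 0 t)) (curveLength γ (Icc t 1)) ≤
          ENNReal.ofReal (A * Metric.infDist (γ t) (frontier Ω))

/-- The class `I^c(ω, x₀)` of `c`-John curves in `Ω` connecting the boundary point `ω` to `x₀`:
curves `γ : (0,1] → Ω` with `γ(1) = x₀`, `γ(t) → ω` as `t → 0+`, and
`ℓ(γ|(0,t]) ≤ c d(γ(t), ∂Ω)` for all `t`. Only the values of `γ` on `(0,1]` matter. -/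
structure IsJohnCurve {X : Type*} [MetricSpace X] (c : ℝ) (Ω : Set X) (ω x₀ : X)
    (γ : ℝ → X) : Prop where
  continuousOn : ContinuousOn γ (Ioc 0 1)
  mapsTo : MapsTo γ (Ioc 0 1) Ω
  map_one : γ 1 = x₀
  tendsto : Tendsto γ (𝓝[>] 0) (𝓝 ω)
  length_le : ∀ t ∈ Ioc (0 : ℝ) 1,
    curveLength γ (Ioc 0 t) ≤ ENNReal.ofReal (c * Metric.infDist (γ t) (frontier Ω))

/-- `S ⊂⊂ Ω`: the closure of `S` is compact and contained in `Ω`. -/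
def IsCompactlyContained {X : Type*} [MetricSpace X] (S Ω : Set X) : Prop :=
  IsCompact (closure S) ∧ closure S ⊆ Ω

/-- The class `𝒜₂(σ)` (with exponent `q`) of maps `f : Ω → Y`. There are a nonnegative
`α ∈ L¹(Ω)` and `C ≥ 1` with
`diam f(B) ≤ C (∫_{σB} α dν)^{1/q} (log (1 / diam B))^{1/q}`
for every ball `B = B(x, r)` such that `σB ⊂⊂ Ω` and `diam B < 1`; for `diam B ≥ 1` the
logarithm is not positive and the bound is void. Only the values of `f` on `Ω` matter. -/
def ClassA2 {X : Type*} [MetricSpace X] [MeasurableSpace X] {Y : Type*} [MetricSpace Y]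
    (ν : Measure X) (q : ℝ) (Ω : Set X) (σ : ℝ) (f : X → Y) : Prop :=
  ∃ (α : X → ℝ) (C : ℝ), IntegrableOn α Ω ν ∧ (∀ x ∈ Ω, 0 ≤ α x) ∧ 1 ≤ C ∧
    ∀ x ∈ Ω, ∀ r : ℝ, 0 < r → IsCompactlyContained (Metric.ball x (σ * r)) Ω →
      Metric.diam (Metric.ball x r) < 1 →
      Metric.ediam (f '' Metric.ball x r) ≤
        ENNReal.ofReal (C * (∫ y in Metric.ball x (σ * r), α y ∂ν) ^ (1 / q) *
          Real.log (1 / Metric.diam (Metric.ball x r)) ^ (1 / q))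

/-- A doubling gauge function `h : [0,∞) → [0,∞)`: continuous, increasing, `h(0) = 0`, and
`h(2t) ≤ D h(t)` for some constant `D` and all `t > 0`. Only the values on `[0,∞)` matter. -/
structure IsDoublingGauge (h : ℝ → ℝ) : Prop where
  continuousOn : ContinuousOn h (Ici 0)
  monotoneOn : MonotoneOn h (Ici 0)
  map_zero : h 0 = 0
  doubling : ∃ D : ℝ, ∀ t : ℝ, 0 < t → h (2 * t) ≤ D * h t

/-- The generalized Hausdorff measure `𝓗^h` with gauge `h`. -/
def hausdorffGauge {X : Type*} [MetricSpace X] [MeasurableSpace X] [BorelSpace X]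
    (h : ℝ → ℝ) : Measure X :=
  Measure.mkMetric (fun d => ENNReal.ofReal (h d.toReal))

end JohnLimits

end

/-! Let m be the finite measure α dν on Ω and r_k = δ 2⁻ᵏ. On a Whitney ball at scale r_k near ω ∈
∂Ω, the class inequality bounds the oscillation of f by C ((k+1) m(W_k(ω)))^(1/q), where W_k(ω) is
the Whitney region of ω at that scale and the factor k+1 comes from the logarithm
(`ClassA2.exists_oscillation_bound`). If these bounds are summable at ω, chains of boundedly many
balls per scale make f Cauchy along each John curve (`IsJohnCurve.exists_tendsto`). Joining two John
curves at each scale by a uniform curve shows that their limits agree (`IsJohnCurve.limit_unique`).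

With H_k comparable to the gauge value at scale r_k, Young's inequality with exponents q and q/(q-1)
bounds the series by ∑ m(W_k(ω))/H_k + ∑ ((k+1) H_k)^(1/(q-1)) (`tsum_rpow_ne_top`). The second sum
is finite by the integral condition (`IsDoublingGauge.summable_gaugeWeight`), so only divergence of
the first can be harmful.

The main point is that this divergence set is null (`IsAhlforsRegular.hausdorffGauge_divergence`).
Nets of ∂Ω at the scales r_k form a tree. Bounded overlap of the Whitney regions gives ∑ c H < ∞
over its vertices, with c = m(W)/H. Cutting each path where its partial sum of c crosses a level θ
costs, integrated over θ ∈ (0,∞), at most ∑ c H. Hence some θ gives an arbitrarily cheap cut, and it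
meets every divergent path (`exists_small_cut`). The balls at the cut vertices cover the divergence
set with small total gauge. -/

namespace JohnLimits

/-! ### Separated nets and packing in Ahlfors regular sets -/

/-- Every set contains a maximal `s`-separated subset, which is an `s`-net of it. -/
theorem exists_separated_net {X : Type*} [MetricSpace X] (T : Set X) {s : ℝ} (hs : 0 < s) :
    ∃ N ⊆ T, (∀ x ∈ N, ∀ y ∈ N, x ≠ y → s < dist x y) ∧ ∀ x ∈ T, ∃ y ∈ N, dist x y ≤ s := by
  obtain ⟨N, hN⟩ := zorn_subset {N : Set X | N ⊆ T ∧ ∀ x ∈ N, ∀ y ∈ N, x ≠ y → s < dist x y} (by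
    intro C hC hchain
    refine ⟨⋃₀ C, ⟨sUnion_subset fun A hA => (hC hA).1, ?_⟩, fun A hA => subset_sUnion_of_mem hA⟩
    rintro x ⟨A, hA, hxA⟩ y ⟨B, hB, hyB⟩ hxy
    rcases hchain.total hA hB with hAB | hAB
    · exact (hC hB).2 x (hAB hxA) y hyB hxy
    · exact (hC hA).2 x hxA y (hAB hyB) hxy)
  refine ⟨N, hN.prop.1, hN.prop.2, fun x hx => ?_⟩
  by_contra! hcon
  have hxN : x ∈ N := by
    refine hN.le_of_ge (y := insert x N) ⟨insert_subset hx hN.prop.1, ?_⟩ (subset_insert _ _)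
      (mem_insert _ _)
    rintro a (rfl | ha) b (rfl | hb) hab
    · exact absurd rfl hab
    · exact hcon b hb
    · rw [dist_comm]; exact hcon a ha
    · exact hN.prop.2 a ha b hb hab
  have := hcon x hxN
  simp only [dist_self] at this
  linarith

section Packing

variable {X : Type*} [MetricSpace X] [MeasurableSpace X] [BorelSpace X]
  {ν : Measure X} {q K : ℝ} {Ω : Set X}

/-- An `s`-separated subset of `closure Ω` in a ball of radius `R` has at most
`K ^ 2 (16 R / s) ^ q` points. -/
theorem IsAhlforsRegular.card_le (hreg : IsAhlforsRegular ν q K Ω) (hΩ : IsOpen Ω) (hK : 1 ≤ K)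
    {s R : ℝ} (hs : 0 < s) (hsR : s ≤ R) (hR : 4 * R < Metric.diam Ω) (z : X) (S : Finset X)
    (hSΩ : ∀ x ∈ S, x ∈ closure Ω) (hSz : ∀ x ∈ S, dist x z ≤ R)
    (hsep : ∀ x ∈ S, ∀ y ∈ S, x ≠ y → s < dist x y) :
    (S.card : ℝ) ≤ K ^ 2 * (16 * R / s) ^ q := by
  have hR0 : 0 < R := hs.trans_le hsR
  have hK0 : 0 < K := by linarith
  rcases S.eq_empty_or_nonempty with rfl | ⟨x₀, hx₀⟩
  · simp only [Finset.card_empty, Nat.cast_zero]; positivity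
  -- Regularity is available only at points of Ω, so each point of S is moved into Ω by less than
  -- s/4. Balls of radius s/4 about the moved points stay disjoint, since 4 · (s/4) = s.
  have hw : ∀ x : X, ∃ w : X, x ∈ S → w ∈ Ω ∧ dist x w < s / 4 := by
    intro x
    by_cases hx : x ∈ S
    · obtain ⟨w, hw, hxw⟩ := Metric.mem_closure_iff.1 (hSΩ x hx) (s / 4) (by positivity)
      exact ⟨w, fun _ => ⟨hw, hxw⟩⟩
    · exact ⟨x, fun h => absurd h hx⟩
  choose w hw using hw
  have hdisj : (S : Set X).PairwiseDisjoint fun x => Metric.ball (w x) (s / 4) ∩ Ω := by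
    intro x hx y hy hxy
    refine Set.disjoint_left.2 fun a ha hb => ?_
    have h1 := (hw x hx).2
    have h2 := (hw y hy).2
    have h3 := ha.1
    have h4 := hb.1
    rw [Metric.mem_ball] at h3 h4
    have h5 := hsep x hx y hy hxy
    have h6 := dist_triangle4 x (w x) a y
    have h7 := dist_triangle a (w y) y
    rw [dist_comm (w x) a] at h6
    rw [dist_comm (w y) y] at h7
    linarith
  have hsub : (⋃ x ∈ S, Metric.ball (w x) (s / 4) ∩ Ω) ⊆ Metric.ball (w x₀) (4 * R) ∩ Ω := by
    refine iUnion₂_subset fun x hx a ha => ⟨?_, ha.2⟩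
    have h1 := (hw x hx).2
    have h2 := (hw x₀ hx₀).2
    have h3 := ha.1
    rw [Metric.mem_ball] at h3 ⊢
    have h4 := dist_triangle4 a (w x) x z
    have h5 := dist_triangle4 a z x₀ (w x₀)
    have h6 := hSz x hx
    have h7 := hSz x₀ hx₀
    rw [dist_comm (w x) x] at h4
    rw [dist_comm z x₀] at h5
    linarith
  have hsum : (S.card : ENNReal) * ENNReal.ofReal ((s / 4) ^ q / K)
      ≤ ENNReal.ofReal (K * (4 * R) ^ q) := by
    calc (S.card : ENNReal) * ENNReal.ofReal ((s / 4) ^ q / K)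
        = ∑ x ∈ S, ENNReal.ofReal ((s / 4) ^ q / K) := by simp
      _ ≤ ∑ x ∈ S, ν (Metric.ball (w x) (s / 4) ∩ Ω) :=
          Finset.sum_le_sum fun x hx =>
            (hreg (w x) (hw x hx).1 (s / 4) (by positivity) (by linarith)).1
      _ = ν (⋃ x ∈ S, Metric.ball (w x) (s / 4) ∩ Ω) :=
          (measure_biUnion_finset hdisj fun x _ =>
            Metric.isOpen_ball.measurableSet.inter hΩ.measurableSet).symm
      _ ≤ ν (Metric.ball (w x₀) (4 * R) ∩ Ω) := measure_mono hsub
      _ ≤ _ := (hreg (w x₀) (hw x₀ hx₀).1 (4 * R) (by positivity) hR).2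
  rw [← ENNReal.ofReal_natCast, ← ENNReal.ofReal_mul (by positivity),
    ENNReal.ofReal_le_ofReal_iff (by positivity)] at hsum
  have hpos : 0 < (s / 4) ^ q := by positivity
  have h1 : (16 * R / s) ^ q = (4 * R) ^ q / (s / 4) ^ q := by
    rw [← Real.div_rpow (by positivity) (by positivity)]
    congr 1; field_simp; ring
  rw [h1, mul_div_assoc', le_div_iff₀ hpos]
  rw [mul_div_assoc', div_le_iff₀ hK0] at hsum
  linarith

/-- Separated subsets of `closure Ω` in small balls are finite. -/
theorem IsAhlforsRegular.finite_of_separated (hreg : IsAhlforsRegular ν q K Ω) (hΩ : IsOpen Ω)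
    (hK : 1 ≤ K) {s R : ℝ} (hs : 0 < s) (hsR : s ≤ R) (hR : 4 * R < Metric.diam Ω) (z : X)
    (S : Set X) (hSΩ : S ⊆ closure Ω) (hSz : ∀ x ∈ S, dist x z ≤ R)
    (hsep : ∀ x ∈ S, ∀ y ∈ S, x ≠ y → s < dist x y) : S.Finite := by
  by_contra hinf
  obtain ⟨n, hn⟩ := exists_nat_gt (K ^ 2 * (16 * R / s) ^ q)
  obtain ⟨F, hFS, hF⟩ := Set.Infinite.exists_subset_card_eq hinf n
  have := hreg.card_le hΩ hK hs hsR hR z F (fun x hx => hSΩ (hFS hx)) (fun x hx => hSz x (hFS hx))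
    (fun x hx y hy => hsep x (hFS hx) y (hFS hy))
  rw [hF] at this
  linarith

/-- Small balls contained in an Ahlfors regular set have compact closure. -/
theorem IsAhlforsRegular.isCompact_closure_ball [CompleteSpace X]
    (hreg : IsAhlforsRegular ν q K Ω) (hΩ : IsOpen Ω) (hK : 1 ≤ K) {x : X} {R : ℝ} (hR0 : 0 < R)
    (hR : 4 * R < Metric.diam Ω) (hsub : Metric.ball x R ⊆ Ω) :
    IsCompact (closure (Metric.ball x R)) := by
  refine isCompact_iff_totallyBounded_isComplete.2
    ⟨TotallyBounded.closure ?_, isClosed_closure.isComplete⟩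
  rw [Metric.totallyBounded_iff]
  intro ε hε
  -- The separation is capped at R because the packing bound requires s ≤ R.
  obtain ⟨N, hN, hsep, hnet⟩ := exists_separated_net (Metric.ball x R)
    (s := min (ε / 2) R) (by positivity)
  refine ⟨N, hreg.finite_of_separated hΩ hK (by positivity) (min_le_right _ _) hR x N
    (fun y hy => subset_closure (hsub (hN hy))) (fun y hy => (Metric.mem_ball.1 (hN hy)).le) hsep,
    fun y hy => ?_⟩
  obtain ⟨v, hv, hyv⟩ := hnet y hy
  refine mem_biUnion hv (Metric.mem_ball.2 ?_)
  have := min_le_left (ε / 2) R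
  linarith

end Packing

/-! ### Overlap counting, cuts and paths in trees -/

/-- If every point lies in at most `n` of the sets `s i`, then `∑ μ (s i) ≤ n μ(X)`. -/
theorem tsum_measure_le_of_overlap {X ι : Type*} [MeasurableSpace X] (μ : Measure X)
    (s : ι → Set X) (hs : ∀ i, MeasurableSet (s i)) (n : ℕ)
    (hn : ∀ (x : X) (F : Finset ι), (∀ i ∈ F, x ∈ s i) → F.card ≤ n) :
    ∑' i, μ (s i) ≤ n * μ univ := by
  classical
  rw [ENNReal.tsum_eq_iSup_sum]
  refine iSup_le fun F => ?_
  calc ∑ i ∈ F, μ (s i) = ∑ i ∈ F, ∫⁻ x, (s i).indicator 1 x ∂μ := by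
        simp only [lintegral_indicator_one (hs _)]
    _ = ∫⁻ x, ∑ i ∈ F, (s i).indicator 1 x ∂μ :=
        (lintegral_finsetSum _ fun i _ => measurable_one.indicator (hs i)).symm
    _ ≤ ∫⁻ _, (n : ENNReal) ∂μ := by
        refine lintegral_mono fun x => ?_
        have h1 : ∑ i ∈ F, (s i).indicator (1 : X → ENNReal) x
            = ((F.filter fun i => x ∈ s i).card : ENNReal) := by
          simp [Set.indicator_apply]
        rw [h1]
        exact Nat.cast_le.2 <| hn x (F.filter fun i => x ∈ s i) fun i hi => (Finset.mem_filter.1 hi).2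
    _ = n * μ univ := by simp

/-- The sum of `c` over the ancestors of a vertex of level `k` in a tree with parent maps `p`. -/
noncomputable def ancestorSum {V : Type*} (p : ℕ → V → V) (c : ℕ → V → ENNReal) : ℕ → V → ENNReal
  | 0, v => c 0 v
  | k + 1, v => ancestorSum p c k (p k v) + c (k + 1) v

/-- The sum of `c` over the strict ancestors of a vertex. -/
noncomputable def strictAncestorSum {V : Type*} (p : ℕ → V → V) (c : ℕ → V → ENNReal) : ℕ → V → ENNReal
  | 0, _ => 0
  | k + 1, v => ancestorSum p c k (p k v)

theorem ancestorSum_eq {V : Type*} (p : ℕ → V → V) (c : ℕ → V → ENNReal) (k : ℕ) (v : V) :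
    ancestorSum p c k v = strictAncestorSum p c k v + c k v := by
  cases k <;> simp [ancestorSum, strictAncestorSum]

theorem ancestorSum_path {V : Type*} (p : ℕ → V → V) (c : ℕ → V → ENNReal) {w : ℕ → V}
    (hw : ∀ k, p k (w (k + 1)) = w k) (k : ℕ) :
    ancestorSum p c k (w k) = ∑ j ∈ Finset.range (k + 1), c j (w j) := by
  induction k with
  | zero => simp [ancestorSum]
  | succ k ih => rw [ancestorSum, hw, ih, Finset.sum_range_succ _ (k + 1)]

/-- A fractional cut of small total cost in a tree can be rounded to a cut of small cost: if
`∑ c H < ∞`, there are sets of vertices of arbitrarily small total cost `∑ H` which meet every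
path along which the sum of `c` diverges. -/
theorem exists_small_cut {V : Type*} (N : ℕ → Set V) (p : ℕ → V → V) (c : ℕ → V → ENNReal)
    (H : ℕ → ENNReal) (hH : ∀ k, H k ≠ 0) (hc : ∀ k v, c k v ≠ ⊤)
    (hsum : ∑' i : {i : ℕ × V // i.2 ∈ N i.1}, c i.1.1 i.1.2 * H i.1.1 ≠ ⊤)
    {ε : ENNReal} (hε : ε ≠ 0) :
    ∃ S : Set (ℕ × V), S.Countable ∧ (∀ i ∈ S, i.2 ∈ N i.1 ∧ c i.1 i.2 ≠ 0) ∧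
      ∑' i : S, H i.1.1 ≤ ε ∧
      ∀ w : ℕ → V, (∀ k, w k ∈ N k) → (∀ k, p k (w (k + 1)) = w k) →
        ∑' k, c k (w k) = ⊤ → ∃ k, (k, w k) ∈ S := by
  classical
  set T : Set (ℕ × V) := {i | i.2 ∈ N i.1 ∧ c i.1 i.2 ≠ 0} with hT
  have hTc : T.Countable := by
    have h1 := (Summable.countable_support_ennreal hsum).image Subtype.val
    refine h1.mono ?_
    rintro i ⟨hi, hci⟩
    exact ⟨⟨i, hi⟩, by simp [Function.mem_support, hci, hH], rfl⟩
  have : Countable T := hTc.to_subtype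
  have hsumT : ∑' i : T, c i.1.1 i.1.2 * H i.1.1 ≠ ⊤ := by
    refine ne_top_of_le_ne_top hsum ?_
    exact ENNReal.tsum_comp_le_tsum_of_injective
      (f := fun i : T => (⟨i.1, i.2.1⟩ : {i : ℕ × V // i.2 ∈ N i.1}))
      (fun i j hij => Subtype.ext (by simpa using hij)) _
  -- I i is the set of levels θ that are crossed exactly at the vertex i. Its part in (0,∞) has
  -- length at most c i, so the cost of the cut at level θ has integral at most ∑ c H.
  set I : ℕ × V → Set ℝ := fun i =>
    {θ | strictAncestorSum p c i.1 i.2 ≤ ENNReal.ofReal θ ∧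
      ENNReal.ofReal θ < ancestorSum p c i.1 i.2} with hI
  have hImeas : ∀ i, MeasurableSet (I i) := fun i =>
    (measurableSet_le measurable_const ENNReal.measurable_ofReal).inter
      (measurableSet_lt ENNReal.measurable_ofReal measurable_const)
  have hIvol : ∀ i, volume (I i ∩ Ioi 0) ≤ c i.1 i.2 := by
    intro i
    by_cases htop : strictAncestorSum p c i.1 i.2 = ⊤
    · have : I i = ∅ := by
        ext θ; simp [hI, htop]
      simp [this]
    have hsub : I i ∩ Ioi 0 ⊆ Ico (strictAncestorSum p c i.1 i.2).toReal
        ((strictAncestorSum p c i.1 i.2).toReal + (c i.1 i.2).toReal) := by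
      rintro θ ⟨⟨h1, h2⟩, h3⟩
      have h3' : 0 ≤ θ := le_of_lt h3
      refine ⟨ENNReal.toReal_le_of_le_ofReal h3' h1, ?_⟩
      rw [ancestorSum_eq] at h2
      rw [← ENNReal.toReal_add htop (hc _ _)]
      exact (ENNReal.ofReal_lt_iff_lt_toReal h3'
        (ENNReal.add_ne_top.2 ⟨htop, hc _ _⟩)).1 h2
    refine (measure_mono hsub).trans ?_
    rw [Real.volume_Ico, add_sub_cancel_left, ENNReal.ofReal_toReal (hc _ _)]
  have hint : ∫⁻ θ in Ioi (0 : ℝ), ∑' i : T, (I i.1).indicator (fun _ => H i.1.1) θ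
      ≤ ∑' i : T, c i.1.1 i.1.2 * H i.1.1 := by
    rw [lintegral_tsum (f := fun (i : T) => (I i.1).indicator (fun _ => H i.1.1))
      fun i => (measurable_const.indicator (hImeas i.1)).aemeasurable]
    refine ENNReal.tsum_le_tsum fun i => ?_
    rw [lintegral_indicator_const (hImeas _), Measure.restrict_apply (hImeas _), mul_comm]
    gcongr
    exact hIvol i.1
  -- The half-line has infinite length, so a cost above ε at every level would make the integral
  -- infinite.
  obtain ⟨θ, -, hθ⟩ : ∃ θ ∈ Ioi (0 : ℝ),
      ∑' i : T, (I i.1).indicator (fun _ => H i.1.1) θ ≤ ε := by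
    by_contra! hcon
    refine hsumT (top_le_iff.1 ?_)
    calc (⊤ : ENNReal) = ∫⁻ _ in Ioi (0 : ℝ), ε := by
          rw [setLIntegral_const, Real.volume_Ioi, ENNReal.mul_top hε]
      _ ≤ _ := (setLIntegral_mono' measurableSet_Ioi fun θ h => (hcon θ h).le)
      _ ≤ _ := hint
  refine ⟨{i | i ∈ T ∧ θ ∈ I i}, hTc.mono fun i hi => hi.1, fun i hi => hi.1, ?_, ?_⟩
  · refine le_trans ?_ hθ
    rw [← tsum_subtype_eq_of_support_subset
      (f := fun i : T => (I i.1).indicator (fun _ => H i.1.1) θ) (s := {i : T | θ ∈ I i.1})]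
    · refine le_of_eq_of_le ?_ (ENNReal.tsum_comp_le_tsum_of_injective
        (f := fun i : {i | i ∈ T ∧ θ ∈ I i} =>
          (⟨⟨i.1, i.2.1⟩, i.2.2⟩ : {i : T | θ ∈ I i.1})) ?_ _)
      · refine tsum_congr fun i => ?_
        simp only [Set.indicator_of_mem i.2.2]
      · intro i j hij
        exact Subtype.ext (by simpa using hij)
    · intro i hi
      by_contra hcon
      exact hi (Set.indicator_of_notMem (s := I i.1) hcon _)
  · intro w hwN hw hdiv
    have hlim : Tendsto (fun k => ∑ j ∈ Finset.range k, c j (w j)) atTop (𝓝 ⊤) := by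
      have := ENNReal.tendsto_nat_tsum fun k => c k (w k)
      rwa [hdiv] at this
    have hex : ∃ k, ENNReal.ofReal θ < ∑ j ∈ Finset.range (k + 1), c j (w j) :=
      (((tendsto_add_atTop_iff_nat 1).2 hlim).eventually
        (lt_mem_nhds ENNReal.ofReal_lt_top)).exists
    have hk := Nat.find_spec hex
    have hmin := fun m (hm : m < Nat.find hex) => Nat.find_min hex hm
    set k := Nat.find hex
    have h1 : ENNReal.ofReal θ < ancestorSum p c k (w k) := by rwa [ancestorSum_path p c hw]
    have h2 : strictAncestorSum p c k (w k) ≤ ENNReal.ofReal θ := by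
      cases hkk : k with
      | zero => simp [strictAncestorSum]
      | succ j =>
        rw [strictAncestorSum, hw, ancestorSum_path p c hw]
        exact not_lt.1 (hmin j (by omega))
    -- The first index at which the partial sum exceeds θ has c ≠ 0, since otherwise the strict sum
    -- would already exceed θ.
    refine ⟨k, ⟨hwN k, fun h0 => ?_⟩, h2, h1⟩
    rw [ancestorSum_eq, h0, add_zero] at h1
    exact absurd h1 (not_lt.2 h2)

/-- Paths in a hierarchy of nets: if `N k` is an `r k`-net of `T` with projections `p k`, and the
nets are locally finite, every point of `T` is the limit of a path of the tree with parent
maps `p`. -/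
theorem exists_path {X : Type*} [MetricSpace X] {T : Set X} {N : ℕ → Set X} {p : ℕ → X → X}
    {δ : ℝ} (hNT : ∀ k, N k ⊆ T)
    (hp : ∀ k, ∀ x ∈ T, p k x ∈ N k ∧ dist x (p k x) ≤ δ * (1 / 2) ^ k)
    {ω : X} (hω : ω ∈ T) (hfin : ∀ k, {v ∈ N k | dist v ω ≤ 2 * (δ * (1 / 2) ^ k)}.Finite) :
    ∃ w : ℕ → X, (∀ k, w k ∈ N k) ∧ (∀ k, p k (w (k + 1)) = w k) ∧
      ∀ k, dist (w k) ω ≤ 2 * (δ * (1 / 2) ^ k) := by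
  have hanc : ∃ A : ℕ → ℕ → X, (∀ n k, A n k ∈ N k ∧ dist (A n k) ω ≤ 2 * (δ * (1 / 2) ^ k)) ∧
      ∀ n k, k < n → p k (A n (k + 1)) = A n k := by
    have hstep : ∀ n, ∃ B : ℕ → X,
        (∀ k, B k ∈ N k ∧ dist (B k) ω ≤ 2 * (δ * (1 / 2) ^ k)) ∧
        ∀ k, k < n → p k (B (k + 1)) = B k := by
      intro n
      have hδ : 0 ≤ δ := by
        have := (hp 0 ω hω).2
        simp only [pow_zero, mul_one] at this
        exact dist_nonneg.trans this
      have hbase : ∀ k, p k ω ∈ N k ∧ dist (p k ω) ω ≤ 2 * (δ * (1 / 2) ^ k) := fun k =>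
        ⟨(hp k ω hω).1, by
          rw [dist_comm]
          have := (hp k ω hω).2
          have h2 : 0 ≤ δ * (1 / 2) ^ k := by positivity
          linarith⟩
      -- Start from the projections of ω and replace the entries at levels n-1, n-2, … by parents.
      -- The distance bound survives because r_k + 2 r_(k+1) = 2 r_k for r_k = δ 2⁻ᵏ.
      have key : ∀ j ≤ n, ∃ B : ℕ → X,
          (∀ k, B k ∈ N k ∧ dist (B k) ω ≤ 2 * (δ * (1 / 2) ^ k)) ∧
          ∀ k, n - j ≤ k → k < n → p k (B (k + 1)) = B k := by
        intro j
        induction j with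
        | zero => exact fun _ => ⟨fun k => p k ω, hbase, fun k h1 h2 => by omega⟩
        | succ j ih =>
          intro hj
          obtain ⟨B, hB, hBp⟩ := ih (by omega)
          have hm : n - (j + 1) + 1 = n - j := by omega
          obtain ⟨m, hmn⟩ : ∃ m, m = n - (j + 1) := ⟨_, rfl⟩
          rw [← hmn] at hm
          refine ⟨Function.update B m (p m (B (m + 1))), fun k => ?_, fun k h1 h2 => ?_⟩
          · rcases eq_or_ne k m with rfl | hkm
            · rw [Function.update_self]
              have h3 := hp k (B (k + 1)) (hNT _ (hB (k + 1)).1)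
              refine ⟨h3.1, ?_⟩
              have h4 := (hB (k + 1)).2
              have h5 := dist_triangle (p k (B (k + 1))) (B (k + 1)) ω
              rw [dist_comm (p k _) (B _)] at h5
              rw [pow_succ] at h4
              linarith [h3.2]
            · rw [Function.update_of_ne hkm]; exact hB k
          · rcases eq_or_ne k m with rfl | hkm
            · rw [Function.update_self, Function.update_of_ne (by omega)]
            · rw [Function.update_of_ne hkm, Function.update_of_ne (by omega)]
              exact hBp k (by omega) h2
      obtain ⟨B, hB, hBp⟩ := key n le_rfl
      exact ⟨B, hB, fun k hk => hBp k (by omega) hk⟩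
    choose A h1 h2 using hstep
    exact ⟨A, h1, h2⟩
  obtain ⟨A, hA, hAp⟩ := hanc
  have hlim : ∀ k, ∃ v ∈ {v ∈ N k | dist v ω ≤ 2 * (δ * (1 / 2) ^ k)},
      ∀ᶠ n in (hyperfilter ℕ : Filter ℕ), A n k = v := by
    intro k
    -- A König-type compactness step: each level has finitely many candidates, so the ultrafilter
    -- selects one, and finitely many selections hold simultaneously for some large n.
    have := (Ultrafilter.eventually_exists_mem_iff (f := hyperfilter ℕ)
      (P := fun v n => A n k = v) (hfin k)).1 (Eventually.of_forall fun n => ⟨A n k, hA n k, rfl⟩)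
    exact this
  choose w hw hwA using hlim
  refine ⟨w, fun k => (hw k).1, fun k => ?_, fun k => (hw k).2⟩
  have hev : ∀ᶠ n in (hyperfilter ℕ : Filter ℕ), k < n :=
    (Nat.hyperfilter_le_atTop) (eventually_gt_atTop k)
  obtain ⟨n, h1, h2, h3⟩ := ((hwA k).and ((hwA (k + 1)).and hev)).exists
  rw [← h1, ← h2, hAp n k h3]

/-! ### Whitney regions and the null set of divergence -/

/-- The points of `Ω` at distance at most `B r` from `x` and at least `τ r` from the boundary. -/
def whitneyRegion {X : Type*} [MetricSpace X] (Ω : Set X) (B τ r : ℝ) (x : X) : Set X :=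
  {y | dist y x ≤ B * r ∧ τ * r ≤ Metric.infDist y (frontier Ω)}

/-- A positive modification of the gauge values at the scales `4 δ 2⁻ᵏ`. -/
noncomputable def gaugeWeight (h : ℝ → ℝ) (δ : ℝ) (k : ℕ) : ℝ :=
  h (4 * (δ * (1 / 2) ^ k)) + (1 / 2) ^ k / (k + 1)

theorem measurableSet_whitneyRegion {X : Type*} [MetricSpace X] [MeasurableSpace X]
    [BorelSpace X] (Ω : Set X) (B τ r : ℝ) (x : X) : MeasurableSet (whitneyRegion Ω B τ r x) :=
  ((isClosed_le (continuous_id.dist continuous_const) continuous_const).inter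
    (isClosed_le continuous_const (Metric.continuous_infDist_pt (frontier Ω)))).measurableSet

theorem IsDoublingGauge.nonneg {h : ℝ → ℝ} (hh : IsDoublingGauge h) {t : ℝ} (ht : 0 ≤ t) :
    0 ≤ h t := by
  rw [← hh.map_zero]
  exact hh.monotoneOn self_mem_Ici ht ht

/-- The extra summand 2⁻ᵏ/(k+1) permits division by the weight even where h vanishes. Multiplied by
k+1 it becomes geometric, so it does not affect the summability needed later. -/
theorem IsDoublingGauge.gaugeWeight_pos {h : ℝ → ℝ} (hh : IsDoublingGauge h) {δ : ℝ} (hδ : 0 < δ)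
    (k : ℕ) : 0 < gaugeWeight h δ k := by
  have := hh.nonneg (t := 4 * (δ * (1 / 2) ^ k)) (by positivity)
  unfold gaugeWeight
  positivity

section Overlap

variable {X : Type*} [MetricSpace X] [MeasurableSpace X] [BorelSpace X]
  {ν : Measure X} {q K : ℝ} {Ω : Set X}

/-- Whitney regions over the points of boundary nets have bounded overlap. -/
theorem IsAhlforsRegular.exists_overlap (hreg : IsAhlforsRegular ν q K Ω) (hΩ : IsOpen Ω)
    (hK : 1 ≤ K) {δ B τ : ℝ} (hδ : 0 < δ) (hB : 1 ≤ B) (hτ : 0 < τ)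
    (hδB : 4 * (B * δ) < Metric.diam Ω) {N : ℕ → Set X} (hN : ∀ k, N k ⊆ frontier Ω)
    (hsep : ∀ k, ∀ x ∈ N k, ∀ y ∈ N k, x ≠ y → δ * (1 / 2) ^ k < dist x y) :
    ∃ n : ℕ, ∀ (x : X) (F : Finset {i : ℕ × X // i.2 ∈ N i.1}),
      (∀ i ∈ F, x ∈ whitneyRegion Ω B τ (δ * (1 / 2) ^ i.1.1) i.1.2) → F.card ≤ n := by
  classical
  -- Packing allows n vertices per level. A point in regions of levels i and j satisfies τ r_i ≤
  -- d(x, ∂Ω) ≤ B r_j, which confines the levels to a window of length p.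
  obtain ⟨n, hn⟩ := exists_nat_ge (K ^ 2 * (16 * B) ^ q)
  obtain ⟨p, hp⟩ := pow_unbounded_of_one_lt (B / τ) (one_lt_two (α := ℝ))
  refine ⟨n * p, fun x F hF => ?_⟩
  have hr : ∀ k : ℕ, 0 < δ * (1 / 2 : ℝ) ^ k := fun k => by positivity
  have hlevel : ∀ i ∈ F, ∀ j ∈ F, j.1.1 < i.1.1 + p := by
    intro i hi j hj
    have h1 := (hF i hi).2
    have h2 := (hF j hj).1
    have h3 : Metric.infDist x (frontier Ω) ≤ dist x j.1.2 :=
      Metric.infDist_le_dist_of_mem (hN _ j.2)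
    by_contra! hcon
    obtain ⟨e, he⟩ := Nat.exists_eq_add_of_le hcon
    have h4 : τ * (δ * (1 / 2) ^ i.1.1) ≤ B * (δ * (1 / 2) ^ j.1.1) := by linarith
    rw [he, pow_add, pow_add] at h4
    have h5 : ((1 : ℝ) / 2) ^ e ≤ 1 := pow_le_one₀ (by norm_num) (by norm_num)
    have h6 := hr i.1.1
    have h7 : B < 2 ^ p * τ := by rwa [div_lt_iff₀ hτ] at hp
    have h8 : ((1 : ℝ) / 2) ^ p * 2 ^ p = 1 := by rw [← mul_pow]; norm_num
    have h9 : τ ≤ B * ((1 / 2) ^ p * (1 / 2) ^ e) := by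
      refine le_of_mul_le_mul_right ?_ h6
      calc _ ≤ _ := h4
        _ = _ := by ring
    have h10 : B * ((1 / 2) ^ p * (1 / 2) ^ e) ≤ B * ((1 / 2) ^ p * 1) := by gcongr
    have h11 : B * (1 / 2) ^ p < 2 ^ p * τ * (1 / 2) ^ p :=
      mul_lt_mul_of_pos_right h7 (by positivity)
    have h12 : 2 ^ p * τ * (1 / 2) ^ p = τ := by linear_combination τ * h8
    linarith
  have himage : (F.image fun i => i.1.1).card ≤ p := by
    rcases F.eq_empty_or_nonempty with rfl | hne
    · simp
    obtain ⟨i, hi, hmin⟩ := F.exists_min_image (fun i => i.1.1) hne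
    calc _ ≤ (Finset.Ico i.1.1 (i.1.1 + p)).card := by
          refine Finset.card_le_card fun k hk => ?_
          obtain ⟨j, hj, rfl⟩ := Finset.mem_image.1 hk
          exact Finset.mem_Ico.2 ⟨hmin j hj, hlevel i hi j hj⟩
      _ = p := by simp
  refine (Finset.card_le_mul_card_image F n fun k _ => ?_).trans (Nat.mul_le_mul_left n himage)
  set G := F.filter fun i => i.1.1 = k
  have hGk : ∀ i ∈ G, i.1.1 = k := fun i hi => (Finset.mem_filter.1 hi).2
  have hGF : ∀ i ∈ G, i ∈ F := fun i hi => (Finset.mem_filter.1 hi).1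
  have hcard : (G.image fun i => i.1.2).card = G.card := by
    refine Finset.card_image_of_injOn fun i hi j hj hij => ?_
    exact Subtype.ext (Prod.ext ((hGk i hi).trans (hGk j hj).symm) hij)
  have hpow : ((1 : ℝ) / 2) ^ k ≤ 1 := pow_le_one₀ (by norm_num) (by norm_num)
  have hmem : ∀ v ∈ G.image fun i => i.1.2, v ∈ N k ∧ dist v x ≤ B * (δ * (1 / 2) ^ k) := by
    intro v hv
    obtain ⟨i, hi, rfl⟩ := Finset.mem_image.1 hv
    have h1 := i.2
    have h2 := (hF i (hGF i hi)).1
    rw [hGk i hi] at h1 h2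
    exact ⟨h1, by rwa [dist_comm]⟩
  have := hreg.card_le hΩ hK (hr k) (R := B * (δ * (1 / 2) ^ k))
    (le_mul_of_one_le_left (hr k).le hB)
    (lt_of_le_of_lt (by
      have : δ * (1 / 2) ^ k ≤ δ := mul_le_of_le_one_right hδ.le hpow
      gcongr) hδB) x (G.image fun i => i.1.2)
    (fun v hv => frontier_subset_closure (hN k (hmem v hv).1)) (fun v hv => (hmem v hv).2)
    (fun v hv w hw => hsep k v (hmem v hv).1 w (hmem w hw).1)
  have hq : 16 * (B * (δ * (1 / 2) ^ k)) / (δ * (1 / 2) ^ k) = 16 * B := by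
    have := (hr k).ne'
    field_simp
  rw [hcard, hq] at this
  exact_mod_cast this.trans hn

/-- For a finite measure `m`, the boundary points at which the weighted sum of the measures of the
Whitney regions diverges form a null set for the gauge measure. -/
theorem IsAhlforsRegular.hausdorffGauge_divergence (hreg : IsAhlforsRegular ν q K Ω)
    (hΩ : IsOpen Ω) (hK : 1 ≤ K) {δ B τ : ℝ} (hδ : 0 < δ) (hB : 0 ≤ B) (hτ : 0 < τ)
    (hδB : 4 * ((B + 2) * δ) < Metric.diam Ω) (m : Measure X) [IsFiniteMeasure m] {h : ℝ → ℝ}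
    (hh : IsDoublingGauge h) :
    hausdorffGauge h {ω ∈ frontier Ω | ∑' k, m (whitneyRegion Ω B τ (δ * (1 / 2) ^ k) ω) /
      ENNReal.ofReal (gaugeWeight h δ k) = ⊤} = 0 := by
  classical
  have hr : ∀ k : ℕ, 0 < δ * (1 / 2 : ℝ) ^ k := fun k => by positivity
  choose N hN hsep hnet using fun k => exists_separated_net (frontier Ω) (hr k)
  have hproj : ∀ k, ∀ x, ∃ y, x ∈ frontier Ω → y ∈ N k ∧ dist x y ≤ δ * (1 / 2) ^ k := by
    intro k x
    by_cases hx : x ∈ frontier Ω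
    · obtain ⟨y, hy⟩ := hnet k x hx
      exact ⟨y, fun _ => hy⟩
    · exact ⟨x, fun h => absurd h hx⟩
  choose p hp using hproj
  -- The path approximating ω stays within 2 r_k of it, so regions with constant B + 2 at net points
  -- contain those with constant B at ω.
  obtain ⟨n₀, hn₀⟩ := hreg.exists_overlap hΩ hK hδ (B := B + 2) (by linarith) hτ hδB hN hsep
  have hH0 : ∀ k, ENNReal.ofReal (gaugeWeight h δ k) ≠ 0 := fun k => by
    simpa using hh.gaugeWeight_pos hδ k
  -- Dropping the levels below n forces the cut to use only small balls, and removes only finitely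
  -- many finite terms along a path, so divergence persists.
  set c : ℕ → ℕ → X → ENNReal := fun n k v => if k < n then 0 else
    m (whitneyRegion Ω (B + 2) τ (δ * (1 / 2) ^ k) v) / ENNReal.ofReal (gaugeWeight h δ k) with hc
  have hcut := fun n : ℕ => exists_small_cut N p (c n)
    (fun k => ENNReal.ofReal (gaugeWeight h δ k)) hH0
    (by
      intro k v
      simp only [hc]
      split_ifs
      · simp
      · exact ENNReal.div_ne_top (measure_ne_top _ _) (hH0 k))
    (by
      refine ne_top_of_le_ne_top
        (ENNReal.mul_ne_top (ENNReal.natCast_ne_top n₀) (measure_ne_top m univ))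
        (le_trans (ENNReal.tsum_le_tsum fun i => ?_) (tsum_measure_le_of_overlap m _
          (fun i : {i : ℕ × X // i.2 ∈ N i.1} =>
            measurableSet_whitneyRegion Ω (B + 2) τ (δ * (1 / 2) ^ i.1.1) i.1.2) n₀ hn₀))
      simp only [hc]
      split_ifs
      · simp
      · exact (ENNReal.div_mul_cancel (hH0 _) ENNReal.ofReal_ne_top).le)
    (ε := ((n : ENNReal) + 1)⁻¹) (by simp)
  choose S hScount hSmem hSsum hSpath using hcut
  have : ∀ n, Countable (S n) := fun n => (hScount n).to_subtype
  have hSk : ∀ n, ∀ i ∈ S n, n ≤ i.1 := by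
    intro n i hi
    by_contra! hlt
    exact (hSmem n i hi).2 (by simp [hc, hlt])
  have hdiam : ∀ i : ℕ × X, Metric.ediam (Metric.closedBall i.2 (2 * (δ * (1 / 2) ^ i.1)))
      ≤ ENNReal.ofReal (4 * (δ * (1 / 2) ^ i.1)) := by
    intro i
    refine Metric.ediam_le fun x hx y hy => ?_
    rw [edist_dist]
    refine ENNReal.ofReal_le_ofReal ?_
    have := dist_triangle_right x y i.2
    rw [Metric.mem_closedBall] at hx hy
    linarith
  refine le_antisymm ((Measure.mkMetric_le_liminf_tsum _ (l := atTop)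
    (fun n : ℕ => ENNReal.ofReal (4 * (δ * (1 / 2) ^ n))) ?_
    (fun n (i : S n) => Metric.closedBall i.1.2 (2 * (δ * (1 / 2) ^ i.1.1))) ?_ ?_ _).trans ?_)
    (zero_le)
  · rw [← ENNReal.ofReal_zero]
    refine ENNReal.tendsto_ofReal ?_
    have := (tendsto_pow_atTop_nhds_zero_of_lt_one (r := (1 / 2 : ℝ)) (by norm_num)
      (by norm_num)).const_mul (4 * δ)
    simpa [mul_assoc] using this
  · refine Eventually.of_forall fun n i => (hdiam i.1).trans (ENNReal.ofReal_le_ofReal ?_)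
    have : ((1 : ℝ) / 2) ^ i.1.1 ≤ (1 / 2) ^ n :=
      pow_le_pow_of_le_one (by norm_num) (by norm_num) (hSk n i.1 i.2)
    gcongr
  · refine Eventually.of_forall fun n ω hω => ?_
    obtain ⟨w, hwN, hwp, hwd⟩ := exists_path hN (fun k x hx => hp k x hx) hω.1 (fun k => by
      have hpow : ((1 : ℝ) / 2) ^ k ≤ 1 := pow_le_one₀ (by norm_num) (by norm_num)
      have h1 : δ * (1 / 2) ^ k ≤ δ := mul_le_of_le_one_right hδ.le hpow
      refine hreg.finite_of_separated hΩ hK (hr k) (R := 2 * (δ * (1 / 2) ^ k))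
        (by linarith [hr k]) (by nlinarith) ω _
        (fun v hv => frontier_subset_closure (hN k hv.1)) (fun v hv => hv.2)
        (fun v hv w hw => hsep k v hv.1 w hw.1))
    have hle : ∀ k, m (whitneyRegion Ω B τ (δ * (1 / 2) ^ k) ω) ≤
        m (whitneyRegion Ω (B + 2) τ (δ * (1 / 2) ^ k) (w k)) := by
      refine fun k => measure_mono fun y hy => ⟨?_, hy.2⟩
      have h1 := dist_triangle y ω (w k)
      rw [dist_comm ω] at h1
      linarith [hy.1, hwd k]
    have hdiv : ∑' k, c n k (w k) = ⊤ := by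
      by_contra hcon
      refine ENNReal.add_ne_top.2 ⟨?_, hcon⟩ (top_le_iff.1 (hω.2.symm.le.trans
        ((ENNReal.tsum_le_tsum fun k => ?_).trans (ENNReal.tsum_add (f := fun k => if k < n then
          m (whitneyRegion Ω B τ (δ * (1 / 2) ^ k) ω) / ENNReal.ofReal (gaugeWeight h δ k)
          else 0)).le)))
      · rw [tsum_eq_sum (s := Finset.range n) fun k hk =>
          if_neg (by simpa using hk)]
        refine ENNReal.sum_ne_top.2 fun k _ => ?_
        split_ifs
        · exact ENNReal.div_ne_top (measure_ne_top _ _) (hH0 k)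
        · simp
      · simp only [hc]
        split_ifs
        · simp
        · rw [zero_add]
          exact ENNReal.div_le_div_right (hle k) _
    obtain ⟨k, hk⟩ := hSpath n w hwN hwp hdiv
    exact mem_iUnion.2 ⟨⟨_, hk⟩, by rw [Metric.mem_closedBall, dist_comm]; exact hwd k⟩
  · refine (liminf_le_liminf (Eventually.of_forall fun n => ?_)).trans
      (ENNReal.tendsto_inv_nat_nhds_zero.comp (tendsto_add_atTop_nat 1)).liminf_eq.le
    simp only [Function.comp_apply, Nat.cast_add, Nat.cast_one]
    refine (ENNReal.tsum_le_tsum fun i => ENNReal.ofReal_le_ofReal ?_).trans (hSsum n)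
    have h1 : (Metric.ediam (Metric.closedBall i.1.2 (2 * (δ * (1 / 2) ^ i.1.1)))).toReal ≤
        4 * (δ * (1 / 2) ^ i.1.1) :=
      ENNReal.toReal_le_of_le_ofReal (by positivity) (hdiam i.1)
    have h2 := hh.monotoneOn ENNReal.toReal_nonneg (mem_Ici.2 (by positivity)) h1
    have h3 : (0 : ℝ) ≤ (1 / 2) ^ i.1.1 / ((i.1.1 : ℝ) + 1) := by positivity
    unfold gaugeWeight
    linarith

end Overlap

/-! ### Series over dyadic scales -/

/-- The integral condition on the gauge, in the form of a series over dyadic scales. -/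
theorem IsDoublingGauge.summable_gaugeWeight {h : ℝ → ℝ} (hh : IsDoublingGauge h) {p δ : ℝ}
    (hp : 0 < p) (hδ : 0 < δ) (hδ' : 4 * δ ≤ 1 / 4)
    (hint : IntegrableOn (fun t : ℝ => (h t * Real.log (1 / t)) ^ p / t) (Ioc 0 1)) :
    Summable fun k : ℕ => (((k : ℝ) + 1) * gaugeWeight h δ k) ^ p := by
  have hlog2 : 0 < Real.log 2 := Real.log_pos one_lt_two
  set I : ℕ → Set ℝ := fun k => Ioc ((1 / 2) ^ (k + 2)) ((1 / 2) ^ (k + 1)) with hI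
  set g : ℕ → ℝ := fun k =>
    (h ((1 / 2) ^ (k + 2)) * (((k : ℝ) + 1) * Real.log 2)) ^ p * 2 ^ (k + 1) with hg
  have hhk : ∀ k : ℕ, 0 ≤ h ((1 / 2) ^ (k + 2)) := fun k => hh.nonneg (by positivity)
  have hg0 : ∀ k, 0 ≤ g k := fun k => by
    have := hhk k
    simp only [hg]; positivity
  have hdisj : Pairwise fun i j => Disjoint (I i) (I j) := by
    have key : ∀ i j, i < j → Disjoint (I i) (I j) := by
      intro i j hij
      refine Set.disjoint_left.2 fun t h1 h2 => ?_
      have h3 : ((1 : ℝ) / 2) ^ (j + 1) ≤ (1 / 2) ^ (i + 2) :=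
        pow_le_pow_of_le_one (by norm_num) (by norm_num) (by omega)
      exact absurd h1.1 (not_lt.2 (h2.2.trans h3))
    intro i j hij
    rcases lt_or_gt_of_ne hij with h1 | h1
    · exact key i j h1
    · exact (key j i h1).symm
  have hsub : (⋃ k, I k) ⊆ Ioc 0 1 := by
    refine iUnion_subset fun k t ht => ⟨lt_trans (by positivity) ht.1, ht.2.trans ?_⟩
    exact pow_le_one₀ (by norm_num) (by norm_num)
  -- On a dyadic interval each of h, log(1/t) and 1/t is bounded below by its value at one endpoint.
  have hlow : ∀ k, ∀ t ∈ I k, g k ≤ (h t * Real.log (1 / t)) ^ p / t := by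
    intro k t ht
    have ht0 : 0 < t := lt_trans (by positivity) ht.1
    have h1 : (2 : ℝ) ^ (k + 1) ≤ 1 / t := by
      rw [le_div_iff₀ ht0]
      calc (2 : ℝ) ^ (k + 1) * t ≤ 2 ^ (k + 1) * (1 / 2) ^ (k + 1) := by gcongr; exact ht.2
        _ = 1 := by rw [← mul_pow]; norm_num
    have h2 : ((k : ℝ) + 1) * Real.log 2 ≤ Real.log (1 / t) := by
      have := Real.log_le_log (by positivity) h1
      rw [Real.log_pow] at this
      exact_mod_cast this
    have h3 : h ((1 / 2) ^ (k + 2)) ≤ h t :=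
      hh.monotoneOn (mem_Ici.2 (by positivity)) ht0.le ht.1.le
    have h4 := hhk k
    have h5 := h4.trans h3
    rw [div_eq_mul_one_div]
    simp only [hg]
    have h6 : 0 ≤ Real.log (1 / t) := le_trans (by positivity) h2
    gcongr
  have hfin : ∑' k, ENNReal.ofReal (g k * (1 / 2) ^ (k + 2)) ≠ ⊤ := by
    refine ne_top_of_le_ne_top hint.lintegral_lt_top.ne ?_
    calc ∑' k, ENNReal.ofReal (g k * (1 / 2) ^ (k + 2))
        = ∑' k, ∫⁻ _ in I k, ENNReal.ofReal (g k) := by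
          refine tsum_congr fun k => ?_
          rw [setLIntegral_const, ENNReal.ofReal_mul (hg0 k)]
          simp only [hI, Real.volume_Ioc]
          congr 2
          ring
      _ ≤ ∑' k, ∫⁻ t in I k, ENNReal.ofReal ((h t * Real.log (1 / t)) ^ p / t) :=
          ENNReal.tsum_le_tsum fun k => setLIntegral_mono' measurableSet_Ioc fun t ht =>
            ENNReal.ofReal_le_ofReal (hlow k t ht)
      _ = ∫⁻ t in ⋃ k, I k, ENNReal.ofReal ((h t * Real.log (1 / t)) ^ p / t) :=
          (lintegral_iUnion (fun k => measurableSet_Ioc) hdisj _).symm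
      _ ≤ _ := lintegral_mono_set hsub
  have hsum1 : Summable fun k => g k * (1 / 2) ^ (k + 2) := by
    have := ENNReal.summable_toReal hfin
    refine this.congr fun k => ENNReal.toReal_ofReal ?_
    have := hg0 k
    positivity
  have hsum2 : Summable fun k : ℕ => (((1 : ℝ) / 2) ^ p) ^ k :=
    summable_geometric_of_lt_one (by positivity)
      (Real.rpow_lt_one (by norm_num) (by norm_num) hp)
  refine Summable.of_nonneg_of_le (fun k => ?_) (fun k => ?_)
    ((hsum1.mul_left (2 * (2 / Real.log 2) ^ p)).add (hsum2.mul_left (2 ^ p)))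
  · have := hh.gaugeWeight_pos hδ k
    positivity
  have hx := hhk k
  set x := h ((1 / 2) ^ (k + 2))
  have h1 : ((k : ℝ) + 1) * gaugeWeight h δ k ≤ ((k : ℝ) + 1) * x + (1 / 2) ^ k := by
    have h2 : h (4 * (δ * (1 / 2) ^ k)) ≤ x := by
      refine hh.monotoneOn (mem_Ici.2 (by positivity)) (mem_Ici.2 (by positivity)) ?_
      rw [pow_add]
      have : (0 : ℝ) < (1 / 2) ^ k := by positivity
      nlinarith
    have h3 : ((k : ℝ) + 1) * ((1 / 2) ^ k / ((k : ℝ) + 1)) = (1 / 2) ^ k := by field_simp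
    rw [gaugeWeight, mul_add, h3]
    gcongr
  -- Doubling the larger summand works for every p > 0, so neither convexity nor concavity of the
  -- power is needed.
  have h4 : (((k : ℝ) + 1) * x + (1 / 2) ^ k) ^ p
      ≤ (2 * (((k : ℝ) + 1) * x)) ^ p + (2 * (1 / 2) ^ k) ^ p := by
    rcases le_total (((k : ℝ) + 1) * x) ((1 / 2) ^ k) with h5 | h5
    · refine le_add_of_nonneg_of_le (by positivity) ?_
      gcongr
      linarith
    · refine le_add_of_le_of_nonneg ?_ (by positivity)
      gcongr
      linarith
  have h5 : (2 * (1 / 2) ^ k) ^ p = 2 ^ p * (((1 : ℝ) / 2) ^ p) ^ k := by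
    rw [Real.mul_rpow (by norm_num) (by positivity), ← Real.rpow_natCast, ← Real.rpow_natCast,
      ← Real.rpow_mul (by norm_num), ← Real.rpow_mul (by norm_num), mul_comm p]
  have h6 : (2 * (((k : ℝ) + 1) * x)) ^ p =
      2 * (2 / Real.log 2) ^ p * (g k * (1 / 2) ^ (k + 2)) := by
    have h7 : (2 : ℝ) ^ (k + 1) * (1 / 2) ^ (k + 2) = 1 / 2 := by
      rw [pow_succ (1 / 2 : ℝ), ← mul_assoc, ← mul_pow]; norm_num
    have h8 : 2 * (((k : ℝ) + 1) * x) = 2 / Real.log 2 * (x * (((k : ℝ) + 1) * Real.log 2)) := by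
      field_simp
    rw [h8, Real.mul_rpow (by positivity) (by positivity)]
    simp only [hg]
    linear_combination (-2 * (2 / Real.log 2) ^ p * (x * (((k : ℝ) + 1) * Real.log 2)) ^ p) * h7
  calc _ ≤ _ := Real.rpow_le_rpow (by have := hh.gaugeWeight_pos hδ k; positivity) h1 hp.le
    _ ≤ _ := h4
    _ = _ := by rw [h5, h6]

/-- Convergence of the weighted sums implies convergence of the sums of the oscillation bounds. -/
theorem tsum_rpow_ne_top {q : ℝ} (hq : 1 < q) (a H b : ℕ → ENNReal) (hH0 : ∀ k, H k ≠ 0)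
    (hHt : ∀ k, H k ≠ ⊤) (h1 : ∑' k, a k / H k ≠ ⊤)
    (h2 : ∑' k, (b k * H k) ^ (1 / (q - 1)) ≠ ⊤) : ∑' k, (b k * a k) ^ (1 / q) ≠ ⊤ := by
  have hq0 : 0 < q := by linarith
  have hq1 : 0 < q - 1 := by linarith
  have hconj : q.HolderConjugate (q / (q - 1)) := Real.HolderConjugate.conjExponent hq
  have hc1 : 1 ≤ ENNReal.ofReal q := by
    rw [ENNReal.one_le_ofReal]; exact hq.le
  have hc2 : 1 ≤ ENNReal.ofReal (q / (q - 1)) := by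
    rw [ENNReal.one_le_ofReal]; exact hconj.symm.lt.le
  refine ne_top_of_le_ne_top (ENNReal.add_ne_top.2 ⟨h1, h2⟩) ?_
  rw [← ENNReal.tsum_add]
  refine ENNReal.tsum_le_tsum fun k => ?_
  -- Inserting H splits the term into the two factors to which Young's inequality applies; the
  -- conjugate exponent q/(q-1) turns the power 1/q into 1/(q-1).
  have hsplit : b k * a k = (a k / H k) * (b k * H k) := by
    rw [mul_comm (b k) (H k), ← mul_assoc, ENNReal.div_mul_cancel (hH0 k) (hHt k), mul_comm]
  rw [hsplit, ENNReal.mul_rpow_of_nonneg _ _ (by positivity)]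
  refine (ENNReal.young_inequality _ _ hconj).trans ?_
  rw [← ENNReal.rpow_mul, ← ENNReal.rpow_mul]
  have e1 : 1 / q * q = 1 := by field_simp
  have e2 : 1 / q * (q / (q - 1)) = 1 / (q - 1) := by field_simp
  rw [e1, e2, ENNReal.rpow_one]
  exact add_le_add (ENNReal.div_le_of_le_mul (le_mul_of_one_le_right' hc1))
    (ENNReal.div_le_of_le_mul (le_mul_of_one_le_right' hc2))

/-! ### Chains of balls and dyadic scales on John curves -/

/-- A curve of length at most `n R` is covered by a chain of `n + 1` balls of radius `2 R`. -/
theorem edist_le_of_curveLength {X Y : Type*} [MetricSpace X] [MetricSpace Y] {γ : ℝ → X}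
    {f : X → Y} {R : ℝ} (hR : 0 < R) {D : ENNReal} (n : ℕ) {a b : ℝ} (hab : a ≤ b)
    (hγ : ContinuousOn γ (Icc a b)) (hlen : curveLength γ (Icc a b) ≤ n * ENNReal.ofReal R)
    (hD : ∀ t ∈ Icc a b, Metric.ediam (f '' Metric.ball (γ t) (2 * R)) ≤ D) :
    edist (f (γ a)) (f (γ b)) ≤ (n + 1) * D := by
  have hball : ∀ x, dist x (γ a) < 2 * R → edist (f (γ a)) (f x) ≤ D := fun x hx =>
    (Metric.edist_le_ediam_of_mem (mem_image_of_mem f (Metric.mem_ball_self (by positivity)))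
      (mem_image_of_mem f (Metric.mem_ball.2 hx))).trans (hD a (left_mem_Icc.2 hab))
  induction n generalizing a with
  | zero =>
    have h1 := (eVariationOn.edist_le γ (right_mem_Icc.2 hab) (left_mem_Icc.2 hab)).trans hlen
    simp only [Nat.cast_zero, zero_mul, nonpos_iff_eq_zero, edist_eq_zero] at h1
    simp only [Nat.cast_zero, zero_add, one_mul]
    exact hball _ (by rw [h1, dist_self]; positivity)
  | succ n ih =>
    rcases lt_or_ge (dist (γ b) (γ a)) (2 * R) with hb | hb
    · exact (hball _ hb).trans (le_mul_of_one_le_left' (by simp))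
    -- Stop at a point at distance R from the start: this uses up length at least R, so at most n R
    -- remains, and the point lies strictly inside the ball of radius 2 R.
    have hcont : ContinuousOn (fun t => dist (γ t) (γ a)) (Icc a b) := by fun_prop
    obtain ⟨t, ht, htR⟩ := intermediate_value_Icc hab hcont
      (show R ∈ Icc (dist (γ a) (γ a)) (dist (γ b) (γ a)) from ⟨by simpa using hR.le, by linarith⟩)
    replace htR : dist (γ t) (γ a) = R := htR
    have hsub : Icc t b ⊆ Icc a b := Icc_subset_Icc_left ht.1
    have hvar := eVariationOn.Icc_add_Icc γ (s := univ) ht.1 ht.2 (mem_univ t)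
    simp only [univ_inter] at hvar
    have h1 : ENNReal.ofReal R ≤ eVariationOn γ (Icc a t) := by
      rw [← htR, ← edist_dist]
      exact eVariationOn.edist_le γ (right_mem_Icc.2 ht.1) (left_mem_Icc.2 ht.1)
    have h2 : eVariationOn γ (Icc t b) ≤ n * ENNReal.ofReal R := by
      have h3 : ENNReal.ofReal R + eVariationOn γ (Icc t b)
          ≤ ENNReal.ofReal R + n * ENNReal.ofReal R :=
        calc _ ≤ eVariationOn γ (Icc a t) + eVariationOn γ (Icc t b) := by gcongr
          _ = eVariationOn γ (Icc a b) := hvar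
          _ ≤ _ := hlen
          _ = _ := by push_cast; ring
      exact (ENNReal.add_le_add_iff_left ENNReal.ofReal_ne_top).1 h3
    have h4 := ih ht.2 (hγ.mono hsub) h2 (fun s hs => hD s (hsub hs)) (fun x hx =>
      (Metric.edist_le_ediam_of_mem (mem_image_of_mem f (Metric.mem_ball_self (by positivity)))
        (mem_image_of_mem f (Metric.mem_ball.2 hx))).trans (hD t ht))
    calc edist (f (γ a)) (f (γ b)) ≤ edist (f (γ a)) (f (γ t)) + edist (f (γ t)) (f (γ b)) :=
          edist_triangle _ _ _
      _ ≤ D + (n + 1) * D := add_le_add (hball _ (by rw [htR]; linarith)) h4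
      _ = _ := by push_cast; ring

section JohnCurve

variable {X : Type*} [MetricSpace X] {c : ℝ} {Ω : Set X} {ω x₀ : X} {γ : ℝ → X}

theorem IsJohnCurve.edist_le_curveLength (hγ : IsJohnCurve c Ω ω x₀ γ) {t : ℝ} (ht : 0 < t) :
    edist (γ t) ω ≤ curveLength γ (Ioc 0 t) := by
  have h1 : Tendsto (fun s => edist (γ t) (γ s)) (𝓝[>] 0) (𝓝 (edist (γ t) ω)) :=
    tendsto_const_nhds.edist hγ.tendsto
  refine le_of_tendsto h1 ?_
  filter_upwards [Ioc_mem_nhdsGT ht] with s hs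
  exact eVariationOn.edist_le γ (right_mem_Ioc.2 ht) hs

/-- The length up to t controls the distance of every earlier point to ω. Read with t fixed this
locates the curve near ω; read with s fixed it bounds the boundary distance of later points from
below. -/
theorem IsJohnCurve.dist_le (hγ : IsJohnCurve c Ω ω x₀ γ) (hc : 1 ≤ c) {s t : ℝ} (hs : 0 < s)
    (hst : s ≤ t) (ht : t ≤ 1) : dist (γ s) ω ≤ c * Metric.infDist (γ t) (frontier Ω) := by
  have h1 := (hγ.edist_le_curveLength hs).trans
    ((eVariationOn.mono γ (Ioc_subset_Ioc_right hst)).trans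
      (hγ.length_le t ⟨hs.trans_le hst, ht⟩))
  rw [edist_dist] at h1
  refine (ENNReal.ofReal_le_ofReal_iff ?_).1 h1
  have := Metric.infDist_nonneg (x := γ t) (s := frontier Ω)
  positivity

theorem IsJohnCurve.exists_dist_eq (hγ : IsJohnCurve c Ω ω x₀ γ) {t r : ℝ} (ht : 0 < t)
    (ht1 : t ≤ 1) (hr : 0 < r) (hrt : r ≤ dist (γ t) ω) :
    ∃ s ∈ Ioc 0 t, dist (γ s) ω = r := by
  have h1 : Tendsto (fun s => dist (γ s) ω) (𝓝[>] 0) (𝓝 0) := by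
    have := hγ.tendsto.dist (tendsto_const_nhds (x := ω))
    rwa [dist_self] at this
  obtain ⟨a, ha, har⟩ := ((h1.eventually (gt_mem_nhds hr)).and (Ioc_mem_nhdsGT ht)).exists
  have hγc : ContinuousOn γ (Icc a t) :=
    hγ.continuousOn.mono fun s hs => ⟨har.1.trans_le hs.1, hs.2.trans ht1⟩
  have hcont : ContinuousOn (fun s => dist (γ s) ω) (Icc a t) := by fun_prop
  obtain ⟨s, hs, hsr⟩ := intermediate_value_Icc har.2 hcont ⟨ha.le, hrt⟩
  exact ⟨s, ⟨har.1.trans_le hs.1, hs.2⟩, hsr⟩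

/-- The distance to ω varies continuously from 0 in the limit to at least δ at `x₀`. Choosing each
parameter below the previous one makes the sequence antitone. -/
theorem IsJohnCurve.exists_scales (hγ : IsJohnCurve c Ω ω x₀ γ) {δ : ℝ} (hδ : 0 < δ)
    (hδx : δ ≤ dist x₀ ω) :
    ∃ t : ℕ → ℝ, Antitone t ∧ ∀ k, t k ∈ Ioc 0 1 ∧ dist (γ (t k)) ω = δ * (1 / 2) ^ k := by
  have hr : ∀ k : ℕ, 0 < δ * (1 / 2 : ℝ) ^ k := fun k => by positivity
  obtain ⟨t₀, ht₀, ht₀d⟩ := hγ.exists_dist_eq one_pos le_rfl hδ (by rwa [hγ.map_one])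
  have hstep : ∀ (k : ℕ) (t : {t : ℝ // t ∈ Ioc 0 1 ∧ dist (γ t) ω = δ * (1 / 2) ^ k}),
      ∃ s : {t : ℝ // t ∈ Ioc 0 1 ∧ dist (γ t) ω = δ * (1 / 2) ^ (k + 1)}, s.1 ≤ t.1 := by
    rintro k ⟨t, ht, htd⟩
    obtain ⟨s, hs, hsd⟩ := hγ.exists_dist_eq ht.1 ht.2 (hr (k + 1))
      (by rw [htd, pow_succ]; linarith [hr k])
    exact ⟨⟨s, ⟨hs.1, hs.2.trans ht.2⟩, hsd⟩, hs.2⟩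
  choose next hnext using hstep
  let T : ∀ k : ℕ, {t : ℝ // t ∈ Ioc 0 1 ∧ dist (γ t) ω = δ * (1 / 2) ^ k} := fun k =>
    Nat.rec ⟨t₀, ht₀, by simpa using ht₀d⟩ (fun k t => next k t) k
  exact ⟨fun k => (T k).1, antitone_nat_of_succ_le fun k => hnext k (T k), fun k => (T k).2⟩

end JohnCurve

/-! ### Existence and uniqueness of limits -/

section Limits

variable {X : Type*} [MetricSpace X] {Y : Type*} [MetricSpace Y] {c A δ ε : ℝ} {Ω : Set X}
  {ω x₀ : X} {f : X → Y} {ψ : ℕ → ENNReal}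

/-- Proximity to ω alone does not force a small parameter. By the John condition, s ≤ t k would give
dist (γ s) ω ≤ c δ 2⁻ᵏ, which fails for large k since γ s ≠ ω. -/
theorem IsJohnCurve.tendsto_scales {γ : ℝ → X} (hγ : IsJohnCurve c Ω ω x₀ γ) (hΩ : IsOpen Ω)
    (hω : ω ∈ frontier Ω) (hc : 1 ≤ c) {t : ℕ → ℝ}
    (ht : ∀ k, t k ∈ Ioc 0 1 ∧ dist (γ (t k)) ω = δ * (1 / 2) ^ k) :
    Tendsto t atTop (𝓝[>] 0) := by
  refine tendsto_nhdsWithin_iff.2 ⟨?_, Eventually.of_forall fun k => (ht k).1.1⟩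
  refine tendsto_order.2 ⟨fun a ha => Eventually.of_forall fun k => ha.trans (ht k).1.1,
    fun a ha => ?_⟩
  set s := min a 1
  have hs : 0 < s := lt_min ha one_pos
  have hpos : 0 < dist (γ s) ω := by
    refine dist_pos.2 fun heq => ?_
    have h1 := hγ.mapsTo (show s ∈ Ioc 0 1 from ⟨hs, min_le_right a 1⟩)
    rw [heq] at h1
    rw [hΩ.frontier_eq] at hω
    exact hω.2 h1
  have hlim : Tendsto (fun k : ℕ => c * (δ * (1 / 2 : ℝ) ^ k)) atTop (𝓝 0) := by
    have := (tendsto_pow_atTop_nhds_zero_of_lt_one (r := (1 / 2 : ℝ)) (by norm_num)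
      (by norm_num)).const_mul (c * δ)
    simpa [mul_assoc] using this
  filter_upwards [hlim.eventually (gt_mem_nhds hpos)] with k hk
  refine lt_of_lt_of_le ?_ (min_le_left a 1)
  by_contra! hcon
  have h1 := hγ.dist_le hc hs hcon (ht k).1.2
  have h2 : Metric.infDist (γ (t k)) (frontier Ω) ≤ dist (γ (t k)) ω :=
    Metric.infDist_le_dist_of_mem hω
  rw [(ht k).2] at h2
  nlinarith

/-- Between consecutive scales the curve has length at most c r_k and stays at distance at least
r_k/(2c) from ∂Ω, so n + 1 balls of radius ε r_k suffice with n independent of k. The scales are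
then added up. -/
theorem IsJohnCurve.edist_le_tail {γ : ℝ → X} (hγ : IsJohnCurve c Ω ω x₀ γ)
    (hω : ω ∈ frontier Ω) (hc : 1 ≤ c) (hδ : 0 < δ) (hε : 0 < ε)
    (hosc : ∀ k x, x ∈ Ω → dist x ω ≤ c * (δ * (1 / 2) ^ k) →
      1 / (2 * c) * (δ * (1 / 2) ^ k) ≤ Metric.infDist x (frontier Ω) →
      Metric.ediam (f '' Metric.ball x (ε * (δ * (1 / 2) ^ k))) ≤ ψ k)
    {t : ℕ → ℝ} (hanti : Antitone t)
    (ht : ∀ k, t k ∈ Ioc 0 1 ∧ dist (γ (t k)) ω = δ * (1 / 2) ^ k) {n : ℕ} (hn : 2 * c / ε ≤ n)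
    (k j : ℕ) : ∀ s ∈ Icc (t (k + j)) (t k),
      edist (f (γ s)) (f (γ (t k))) ≤ (n + 1) * ∑ i ∈ Finset.range j, ψ (k + i) := by
  have hc0 : 0 < c := by linarith
  have hr : ∀ k : ℕ, 0 < δ * (1 / 2 : ℝ) ^ k := fun k => by positivity
  have hfr : ∀ k, Metric.infDist (γ (t k)) (frontier Ω) ≤ δ * (1 / 2) ^ k := fun k => by
    rw [← (ht k).2]; exact Metric.infDist_le_dist_of_mem hω
  have hscale : ∀ k, ∀ s ∈ Icc (t (k + 1)) (t k),
      edist (f (γ s)) (f (γ (t k))) ≤ (n + 1) * ψ k := by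
    intro k s hs
    have hs0 : 0 < s := (ht (k + 1)).1.1.trans_le hs.1
    refine edist_le_of_curveLength (R := ε * (δ * (1 / 2) ^ k) / 2) (by have := hr k; positivity)
      n hs.2 (hγ.continuousOn.mono fun u hu => ⟨hs0.trans_le hu.1, hu.2.trans (ht k).1.2⟩) ?_ ?_
    · have hsub : Icc s (t k) ⊆ Ioc 0 (t k) := fun u hu => ⟨hs0.trans_le hu.1, hu.2⟩
      refine (eVariationOn.mono γ hsub).trans ((hγ.length_le _ (ht k).1).trans ?_)
      rw [← ENNReal.ofReal_natCast, ← ENNReal.ofReal_mul (by positivity)]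
      refine ENNReal.ofReal_le_ofReal ?_
      have h1 : c * Metric.infDist (γ (t k)) (frontier Ω) ≤ c * (δ * (1 / 2) ^ k) := by
        gcongr; exact hfr k
      have h2 : 2 * c ≤ n * ε := by rwa [div_le_iff₀ hε] at hn
      nlinarith [hr k]
    · intro u hu
      have hu0 : 0 < u := hs0.trans_le hu.1
      rw [mul_div_cancel₀ _ (two_ne_zero)]
      refine hosc k _ (hγ.mapsTo ⟨hu0, hu.2.trans (ht k).1.2⟩) ?_ ?_
      · refine (hγ.dist_le hc hu0 hu.2 (ht k).1.2).trans ?_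
        gcongr; exact hfr k
      · have h1 := hγ.dist_le hc (ht (k + 1)).1.1 (hs.1.trans hu.1) (hu.2.trans (ht k).1.2)
        rw [(ht (k + 1)).2, pow_succ] at h1
        rw [one_div, inv_mul_le_iff₀ (by positivity)]
        linarith
  induction j with
  | zero =>
    intro s hs
    have : s = t k := le_antisymm hs.2 hs.1
    simp [this]
  | succ j ih =>
    intro s hs
    rw [Finset.sum_range_succ, mul_add]
    rcases le_total (t (k + j)) s with h1 | h1
    · exact (ih s ⟨h1, hs.2⟩).trans le_self_add
    · refine (edist_triangle _ (f (γ (t (k + j)))) _).trans ?_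
      rw [add_comm]
      exact add_le_add (ih _ ⟨le_rfl, hanti (by omega)⟩) (hscale (k + j) s ⟨hs.1, h1⟩)

/-- If the oscillations of `f` on the Whitney balls near `ω` are summable over the dyadic scales,
`f` has a limit along every John curve ending at `ω`. -/
theorem IsJohnCurve.exists_tendsto [CompleteSpace Y] {γ : ℝ → X} (hγ : IsJohnCurve c Ω ω x₀ γ)
    (hΩ : IsOpen Ω) (hω : ω ∈ frontier Ω) (hc : 1 ≤ c) (hδ : 0 < δ) (hδx : δ ≤ dist x₀ ω)
    (hε : 0 < ε)
    (hosc : ∀ k x, x ∈ Ω → dist x ω ≤ c * (δ * (1 / 2) ^ k) →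
      1 / (2 * c) * (δ * (1 / 2) ^ k) ≤ Metric.infDist x (frontier Ω) →
      Metric.ediam (f '' Metric.ball x (ε * (δ * (1 / 2) ^ k))) ≤ ψ k)
    (hψ : ∑' k, ψ k ≠ ⊤) : ∃ a : Y, Tendsto (fun t => f (γ t)) (𝓝[>] 0) (𝓝 a) := by
  obtain ⟨t, hanti, ht⟩ := hγ.exists_scales hδ hδx
  have htend := hγ.tendsto_scales hΩ hω hc ht
  obtain ⟨n, hn⟩ := exists_nat_ge (2 * c / ε)
  refine CompleteSpace.complete (f := map (fun t => f (γ t)) (𝓝[>] 0)) ?_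
  refine EMetric.cauchy_iff.2 ⟨map_neBot.ne, fun η hη => ?_⟩
  have htail : Tendsto (fun k => ((n : ENNReal) + 1) * ∑' i, ψ (i + k)) atTop (𝓝 0) := by
    have := ENNReal.Tendsto.const_mul (a := (n : ENNReal) + 1)
      (ENNReal.tendsto_sum_nat_add ψ hψ) (Or.inr (by simp))
    rwa [mul_zero] at this
  obtain ⟨k, hk⟩ := (htail.eventually (gt_mem_nhds (ENNReal.half_pos hη.ne'))).exists
  have hbound : ∀ s ∈ Ioc 0 (t k), edist (f (γ s)) (f (γ (t k))) < η / 2 := by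
    intro s hs
    refine lt_of_le_of_lt ?_ hk
    obtain ⟨j, hj, hjk⟩ := (((tendsto_nhdsWithin_iff.1 htend).1.eventually
      (gt_mem_nhds hs.1)).and (eventually_ge_atTop k)).exists
    obtain ⟨i, rfl⟩ := Nat.exists_eq_add_of_le hjk
    refine (hγ.edist_le_tail hω hc hδ hε hosc hanti ht hn k i s ⟨hj.le, hs.2⟩).trans ?_
    gcongr
    simp only [add_comm k]
    exact ENNReal.sum_le_tsum _
  refine ⟨(fun t => f (γ t)) '' Ioc 0 (t k), image_mem_map (Ioc_mem_nhdsGT (ht k).1.1), ?_⟩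
  rintro _ ⟨s, hs, rfl⟩ _ ⟨u, hu, rfl⟩
  calc edist (f (γ s)) (f (γ u)) ≤ edist (f (γ s)) (f (γ (t k))) + edist (f (γ u)) (f (γ (t k))) :=
        edist_triangle_right _ _ _
    _ < η / 2 + η / 2 := ENNReal.add_lt_add (hbound s hs) (hbound u hu)
    _ = η := ENNReal.add_halves η

/-- If the oscillations of `f` on the Whitney balls near `ω` tend to zero, the limits along any
two John curves of a uniform domain ending at `ω` agree. -/
theorem IsJohnCurve.limit_unique {γ η : ℝ → X} (hγ : IsJohnCurve c Ω ω x₀ γ)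
    (hη : IsJohnCurve c Ω ω x₀ η) (hΩ : IsOpen Ω) (hunif : IsUniformDomain A Ω) (hA : 0 < A)
    (hω : ω ∈ frontier Ω) (hc : 1 ≤ c) (hδ : 0 < δ) (hδx : δ ≤ dist x₀ ω) (hε : 0 < ε)
    (hosc : ∀ k x, x ∈ Ω → dist x ω ≤ (1 + 2 * A) * (δ * (1 / 2) ^ k) →
      1 / (c * (1 + A)) * (δ * (1 / 2) ^ k) ≤ Metric.infDist x (frontier Ω) →
      Metric.ediam (f '' Metric.ball x (ε * (δ * (1 / 2) ^ k))) ≤ ψ k)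
    (hψ : Tendsto ψ atTop (𝓝 0)) {a b : Y} (ha : Tendsto (fun t => f (γ t)) (𝓝[>] 0) (𝓝 a))
    (hb : Tendsto (fun t => f (η t)) (𝓝[>] 0) (𝓝 b)) : a = b := by
  have hc0 : 0 < c := by linarith
  have hr : ∀ k : ℕ, 0 < δ * (1 / 2 : ℝ) ^ k := fun k => by positivity
  obtain ⟨t, -, ht⟩ := hγ.exists_scales hδ hδx
  obtain ⟨s, -, hs⟩ := hη.exists_scales hδ hδx
  have htend := hγ.tendsto_scales hΩ hω hc ht
  have hstend := hη.tendsto_scales hΩ hω hc hs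
  -- The joining curve has length at most 2 A r_k and each chain step has length ε r_k / 2.
  obtain ⟨n, hn⟩ := exists_nat_ge (4 * A / ε)
  have hn' : 4 * A ≤ n * ε := by rwa [div_le_iff₀ hε] at hn
  have hbound : ∀ k, edist (f (γ (t k))) (f (η (s k))) ≤ (n + 1) * ψ k := by
    intro k
    obtain ⟨β, hβc, hβΩ, hβ0, hβ1, hβlen, hβcig⟩ := hunif (γ (t k)) (hγ.mapsTo (ht k).1)
      (η (s k)) (hη.mapsTo (hs k).1)
    have hlen : curveLength β (Icc 0 1) ≤ ENNReal.ofReal (A * (2 * (δ * (1 / 2) ^ k))) := by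
      refine hβlen.trans (ENNReal.ofReal_le_ofReal ?_)
      gcongr
      have := dist_triangle_right (γ (t k)) (η (s k)) ω
      rw [(ht k).2, (hs k).2] at this
      linarith
    have hend0 : δ * (1 / 2) ^ k ≤ c * Metric.infDist (β 0) (frontier Ω) := by
      rw [hβ0, ← (ht k).2]
      exact hγ.dist_le hc (ht k).1.1 le_rfl (ht k).1.2
    have hend1 : δ * (1 / 2) ^ k ≤ c * Metric.infDist (β 1) (frontier Ω) := by
      rw [hβ1, ← (hs k).2]
      exact hη.dist_le hc (hs k).1.1 le_rfl (hs k).1.2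
    rw [← hβ0, ← hβ1]
    refine edist_le_of_curveLength (R := ε * (δ * (1 / 2) ^ k) / 2) (by have := hr k; positivity)
      n zero_le_one hβc ?_ ?_
    · refine hlen.trans ?_
      rw [← ENNReal.ofReal_natCast, ← ENNReal.ofReal_mul (by positivity)]
      refine ENNReal.ofReal_le_ofReal ?_
      nlinarith [hr k]
    · intro u hu
      rw [mul_div_cancel₀ _ (two_ne_zero)]
      refine hosc k _ (hβΩ hu) ?_ ?_
      · have h1 := (eVariationOn.edist_le β hu (left_mem_Icc.2 zero_le_one)).trans hlen
        rw [edist_dist, ENNReal.ofReal_le_ofReal_iff (by have := hr k; positivity)] at h1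
        have h2 := dist_triangle (β u) (β 0) ω
        rw [hβ0, (ht k).2] at h2
        rw [hβ0] at h1
        linarith
      · have hnn := Metric.infDist_nonneg (x := β u) (s := frontier Ω)
        -- Both endpoints have boundary distance at least r_k/c. Moving from the endpoint on the
        -- shorter side costs at most A d(β u, ∂Ω), hence r_k ≤ c (1 + A) d(β u, ∂Ω).
        have hcig : ∀ e, e = 0 ∨ e = 1 →
            dist (β e) (β u) ≤ A * Metric.infDist (β u) (frontier Ω) →
            1 / (c * (1 + A)) * (δ * (1 / 2) ^ k) ≤ Metric.infDist (β u) (frontier Ω) := by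
          intro e he hde
          have h1 : δ * (1 / 2) ^ k ≤ c * Metric.infDist (β e) (frontier Ω) := by
            rcases he with rfl | rfl
            exacts [hend0, hend1]
          have h2 : Metric.infDist (β e) (frontier Ω) ≤
              Metric.infDist (β u) (frontier Ω) + dist (β e) (β u) :=
            Metric.infDist_le_infDist_add_dist
          rw [one_div, inv_mul_le_iff₀ (by positivity)]
          calc _ ≤ _ := h1
            _ ≤ c * (Metric.infDist (β u) (frontier Ω)
                + A * Metric.infDist (β u) (frontier Ω)) := by gcongr; linarith
            _ = _ := by ring
        rcases min_le_iff.1 (hβcig u hu) with h1 | h1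
        · refine hcig 0 (Or.inl rfl) ?_
          have h2 := (eVariationOn.edist_le β (left_mem_Icc.2 hu.1)
            (right_mem_Icc.2 hu.1)).trans h1
          rwa [edist_dist, ENNReal.ofReal_le_ofReal_iff (by positivity)] at h2
        · refine hcig 1 (Or.inr rfl) ?_
          have h2 := (eVariationOn.edist_le β (right_mem_Icc.2 hu.2)
            (left_mem_Icc.2 hu.2)).trans h1
          rwa [edist_dist, ENNReal.ofReal_le_ofReal_iff (by positivity)] at h2
  have hlim : Tendsto (fun k => ((n : ENNReal) + 1) * ψ k) atTop (𝓝 0) := by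
    have := ENNReal.Tendsto.const_mul (a := (n : ENNReal) + 1) hψ (Or.inr (by simp))
    rwa [mul_zero] at this
  have := le_of_tendsto_of_tendsto' ((ha.comp htend).edist (hb.comp hstend)) hlim hbound
  exact edist_eq_zero.1 (le_antisymm this zero_le)

end Limits

/-! ### The oscillation bound and the assembly -/

/-- In a connected space, a ball that is not too large has diameter at least its radius. -/
theorem le_diam_ball {X : Type*} [MetricSpace X] [PreconnectedSpace X] {x : X} {R : ℝ}
    (h : ∃ y, R ≤ dist y x) : R ≤ Metric.diam (Metric.ball x R) := by
  refine le_of_forall_lt fun s hs => ?_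
  rcases lt_or_ge s 0 with h0 | h0
  · exact h0.trans_le Metric.diam_nonneg
  obtain ⟨u, hsu, huR⟩ := exists_between hs
  obtain ⟨y, hy⟩ := h
  obtain ⟨z, hz⟩ := mem_range_of_exists_le_of_exists_ge
    (f := fun z => dist z x) (continuous_id.dist continuous_const) (c := u)
    ⟨x, by simpa using h0.trans hsu.le⟩ ⟨y, huR.le.trans hy⟩
  replace hz : dist z x = u := hz
  rw [← hz] at hsu huR
  exact hsu.trans_le (Metric.dist_le_diam_of_mem Metric.isBounded_ball (Metric.mem_ball.2 huR)
    (Metric.mem_ball_self (dist_nonneg.trans_lt huR)))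

theorem diam_pos_of_frontier {X : Type*} [MetricSpace X] {Ω : Set X} (hΩ : IsOpen Ω)
    (hb : Bornology.IsBounded Ω) {x₀ ω : X} (hx₀ : x₀ ∈ Ω) (hω : ω ∈ frontier Ω) :
    0 < Metric.diam Ω := by
  rw [hΩ.frontier_eq] at hω
  have hne : ω ≠ x₀ := fun h => hω.2 (h ▸ hx₀)
  obtain ⟨w, hw, hwd⟩ := Metric.mem_closure_iff.1 hω.1 (dist ω x₀) (dist_pos.2 hne)
  refine lt_of_lt_of_le (dist_pos.2 fun h => ?_) (Metric.dist_le_diam_of_mem hb hw hx₀)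
  rw [h] at hwd
  exact lt_irrefl _ hwd

section Main

variable {X : Type*} [MetricSpace X] [MeasurableSpace X] [BorelSpace X]
  {Y : Type*} [MetricSpace Y] {ν : Measure X} {q K σ M δ τ : ℝ} {Ω : Set X} {f : X → Y}

/-- The defining inequality of the class `𝒜₂(σ)` on Whitney balls at dyadic scales. -/
theorem ClassA2.exists_oscillation_bound [CompleteSpace X] [PreconnectedSpace X]
    (hf : ClassA2 ν q Ω σ f) (hq : 1 < q) (hσ : 1 ≤ σ) (hM : 1 ≤ M)
    (hreg : IsAhlforsRegular ν q K Ω) (hΩ : IsOpen Ω) (hK : 1 ≤ K)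
    (hfr : (frontier Ω).Nonempty)
    (hdist : ∀ x ∈ Ω, Metric.infDist x (frontier Ω) ≤ M * Metric.infDist x Ωᶜ)
    (hδ : 0 < δ) (hδ1 : δ < 1) (hδΩ : 4 * δ < Metric.diam Ω) (hτ : 0 < τ) (hτ1 : τ ≤ 1) :
    ∃ (m : Measure X) (C : ENNReal), IsFiniteMeasure m ∧ C ≠ ⊤ ∧
      ∀ (B : ℝ) (k : ℕ) (ω x : X), x ∈ Ω → dist x ω ≤ B * (δ * (1 / 2) ^ k) →
        τ * (δ * (1 / 2) ^ k) ≤ Metric.infDist x (frontier Ω) →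
        Metric.ediam (f '' Metric.ball x (τ / (2 * M * σ) * (δ * (1 / 2) ^ k))) ≤
          C * (((k : ENNReal) + 1) *
            m (whitneyRegion Ω (B + 1) (τ / 2) (δ * (1 / 2) ^ k) ω)) ^ (1 / q) := by
  obtain ⟨α, C, hα, hα0, hC, hfα⟩ := hf
  have hM0 : 0 < M := by linarith
  have hσ0 : 0 < σ := by linarith
  -- With this choice σB has radius τ r/(2M), half the lower bound τ r/M for the distance from x to
  -- the complement of Ω. Thus its closed ball lies in Ω whatever σ ≥ 1 is.
  set ε := τ / (2 * M * σ) with hε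
  have hε0 : 0 < ε := by positivity
  have hσε : σ * ε = τ / (2 * M) := by rw [hε]; field_simp
  have hτM : τ / (2 * M) ≤ τ / 2 := by gcongr; linarith
  have hετ : ε ≤ τ / 2 := le_trans (by rw [← hσε]; exact le_mul_of_one_le_left hε0.le hσ) hτM
  set L := Real.log 2 + |Real.log (ε * δ)| with hL
  have hlog2 : 0 < Real.log 2 := Real.log_pos one_lt_two
  have hL0 : 0 ≤ L := by positivity
  refine ⟨(ν.restrict Ω).withDensity fun x => ENNReal.ofReal (α x),
    ENNReal.ofReal (C * L ^ (1 / q)), isFiniteMeasure_withDensity hα.lintegral_lt_top.ne,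
    ENNReal.ofReal_ne_top, fun B k ω x hx hxω hxd => ?_⟩
  obtain ⟨r, hr⟩ : ∃ r, r = δ * (1 / 2 : ℝ) ^ k := ⟨_, rfl⟩
  rw [← hr] at hxω hxd ⊢
  have hr0 : 0 < r := by rw [hr]; positivity
  have hrδ : r ≤ δ := by
    rw [hr]; exact mul_le_of_le_one_right hδ.le (pow_le_one₀ (by norm_num) (by norm_num))
  have hσr : σ * (ε * r) = τ / (2 * M) * r := by rw [← mul_assoc, hσε]
  have hσr' : σ * (ε * r) ≤ τ / 2 * r := by rw [hσr]; gcongr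
  have hσr0 : 0 < σ * (ε * r) := by positivity
  have hτr : τ / 2 * r ≤ 1 / 2 * r := by gcongr
  have hclosed : Metric.closedBall x (σ * (ε * r)) ⊆ Ω := by
    intro y hy
    by_contra hyΩ
    have h1 : Metric.infDist x Ωᶜ ≤ dist x y := Metric.infDist_le_dist_of_mem hyΩ
    rw [Metric.mem_closedBall, dist_comm] at hy
    have h2 := hdist x hx
    have h3 : M * Metric.infDist x Ωᶜ ≤ M * (σ * (ε * r)) := by gcongr; linarith
    have h4 : M * (σ * (ε * r)) = τ * r / 2 := by rw [hσr]; field_simp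
    have h5 : 0 < τ * r := by positivity
    linarith
  have hballΩ : Metric.ball x (σ * (ε * r)) ⊆ Ω := Metric.ball_subset_closedBall.trans hclosed
  have hcc : IsCompactlyContained (Metric.ball x (σ * (ε * r))) Ω :=
    ⟨hreg.isCompact_closure_ball hΩ hK hσr0 (by linarith) hballΩ,
      Metric.closure_ball_subset_closedBall.trans hclosed⟩
  have hdle : Metric.diam (Metric.ball x (ε * r)) < 1 := by
    refine lt_of_le_of_lt (Metric.diam_ball (by positivity)) ?_
    have : ε * r ≤ 1 / 2 * r := by gcongr; linarith
    linarith
  -- The logarithm is controlled only if the diameter is not much smaller than the radius;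
  -- connectedness and a boundary point outside the ball ensure this.
  have hdge : ε * r ≤ Metric.diam (Metric.ball x (ε * r)) := by
    obtain ⟨y, hy⟩ := hfr
    refine le_diam_ball ⟨y, ?_⟩
    have h1 := Metric.infDist_le_dist_of_mem (x := x) hy
    rw [dist_comm] at h1
    have h2 : ε * r ≤ τ * r := by gcongr; linarith
    linarith
  have hd0 : 0 < Metric.diam (Metric.ball x (ε * r)) := lt_of_lt_of_le (by positivity) hdge
  have hlog0 : 0 ≤ Real.log (1 / Metric.diam (Metric.ball x (ε * r))) :=
    Real.log_nonneg (by rw [le_div_iff₀ hd0]; linarith)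
  have hlog : Real.log (1 / Metric.diam (Metric.ball x (ε * r))) ≤ L * ((k : ℝ) + 1) := by
    have h1 : Real.log (1 / Metric.diam (Metric.ball x (ε * r))) ≤ Real.log (1 / (ε * r)) :=
      Real.log_le_log (by positivity) (by gcongr)
    have h2 : Real.log (1 / (ε * r)) = k * Real.log 2 - Real.log (ε * δ) := by
      rw [hr, ← mul_assoc, one_div, Real.log_inv, Real.log_mul (by positivity) (by positivity),
        Real.log_pow, one_div, Real.log_inv]
      ring
    have h3 := neg_abs_le (Real.log (ε * δ))
    have h4 : 0 ≤ |Real.log (ε * δ)| * k := by positivity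
    rw [h2] at h1
    rw [hL]
    nlinarith
  have hαball : IntegrableOn α (Metric.ball x (σ * (ε * r))) ν := hα.mono_set hballΩ
  have hnn : 0 ≤ᵐ[ν.restrict (Metric.ball x (σ * (ε * r)))] α :=
    (ae_restrict_iff' Metric.isOpen_ball.measurableSet).2
      (Eventually.of_forall fun y hy => hα0 y (hballΩ hy))
  have hI0 : 0 ≤ ∫ y in Metric.ball x (σ * (ε * r)), α y ∂ν := integral_nonneg_of_ae hnn
  have hm : ENNReal.ofReal (∫ y in Metric.ball x (σ * (ε * r)), α y ∂ν) ≤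
      (ν.restrict Ω).withDensity (fun x => ENNReal.ofReal (α x))
        (whitneyRegion Ω (B + 1) (τ / 2) r ω) := by
    rw [ofReal_integral_eq_lintegral_ofReal hαball hnn]
    calc _ = (ν.restrict Ω).withDensity (fun x => ENNReal.ofReal (α x))
          (Metric.ball x (σ * (ε * r))) := by
          rw [withDensity_apply _ Metric.isOpen_ball.measurableSet,
            Measure.restrict_restrict Metric.isOpen_ball.measurableSet,
            inter_eq_left.2 hballΩ]
      _ ≤ _ := by
          refine measure_mono fun y hy => ?_
          rw [Metric.mem_ball] at hy
          have h1 := dist_triangle y x ω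
          have h2 : Metric.infDist x (frontier Ω) ≤ Metric.infDist y (frontier Ω) + dist x y :=
            Metric.infDist_le_infDist_add_dist
          rw [dist_comm x y] at h2
          exact ⟨by linarith, by linarith⟩
  refine (hfα x hx (ε * r) (by positivity) hcc hdle).trans ?_
  set I := ∫ y in Metric.ball x (σ * (ε * r)), α y ∂ν
  calc ENNReal.ofReal (C * I ^ (1 / q) *
        Real.log (1 / Metric.diam (Metric.ball x (ε * r))) ^ (1 / q))
      ≤ ENNReal.ofReal (C * I ^ (1 / q) * (L * ((k : ℝ) + 1)) ^ (1 / q)) := by gcongr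
    _ = ENNReal.ofReal (C * L ^ (1 / q) * (((k : ℝ) + 1) * I) ^ (1 / q)) := by
        rw [Real.mul_rpow hL0 (by positivity), Real.mul_rpow (by positivity) hI0]
        ring_nf
    _ = ENNReal.ofReal (C * L ^ (1 / q)) * (((k : ENNReal) + 1) * ENNReal.ofReal I) ^ (1 / q) := by
        have h1 : ENNReal.ofReal ((k : ℝ) + 1) = (k : ENNReal) + 1 := by
          rw [ENNReal.ofReal_add (by positivity) zero_le_one, ENNReal.ofReal_natCast,
            ENNReal.ofReal_one]
        rw [ENNReal.ofReal_mul (p := C * L ^ (1 / q)) (by positivity),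
          ← ENNReal.ofReal_rpow_of_nonneg (x := ((k : ℝ) + 1) * I) (by positivity)
            (by positivity), ENNReal.ofReal_mul (p := (k : ℝ) + 1) (by positivity), h1]
    _ ≤ _ := by gcongr

/-- Maps of class `𝒜₂(σ)`, for any `σ ≥ 1`, have unique limits along John curves outside a null
set of the gauge measure. -/
theorem ClassA2.limits_along_john_curves [CompleteSpace X] [PreconnectedSpace X]
    [CompleteSpace Y] {c A : ℝ} {x₀ : X} {h : ℝ → ℝ} (hf : ClassA2 ν q Ω σ f) (hq : 1 < q)
    (hK : 1 ≤ K) (hc : 1 ≤ c) (hA : 0 < A) (hM : 1 ≤ M) (hσ : 1 ≤ σ) (hΩ : IsBoundedDomain Ω)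
    (hΩ' : Ω ≠ univ) (hx₀ : x₀ ∈ Ω) (hreg : IsAhlforsRegular ν q K Ω)
    (hdist : ∀ x ∈ Ω, Metric.infDist x (frontier Ω) ≤ M * Metric.infDist x Ωᶜ)
    (hunif : IsUniformDomain A Ω) (hh : IsDoublingGauge h)
    (hint : IntegrableOn (fun t : ℝ => (h t * Real.log (1 / t)) ^ (1 / (q - 1)) / t) (Ioc 0 1)) :
    hausdorffGauge h
      {ω ∈ frontier Ω |
        ¬ ((∀ γ : ℝ → X, IsJohnCurve c Ω ω x₀ γ →
              ∃ a : Y, Tendsto (fun t => f (γ t)) (𝓝[>] 0) (𝓝 a)) ∧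
            (∀ γ η : ℝ → X, IsJohnCurve c Ω ω x₀ γ → IsJohnCurve c Ω ω x₀ η → ∀ a b : Y,
              Tendsto (fun t => f (γ t)) (𝓝[>] 0) (𝓝 a) →
              Tendsto (fun t => f (η t)) (𝓝[>] 0) (𝓝 b) → a = b))} = 0 := by
  have hc0 : 0 < c := by linarith
  have hq0 : 0 < q := by linarith
  have hfr : (frontier Ω).Nonempty := nonempty_frontier_iff.2 ⟨⟨x₀, hx₀⟩, hΩ'⟩
  have hdiam : 0 < Metric.diam Ω :=
    diam_pos_of_frontier hΩ.isOpen hΩ.isBounded hx₀ hfr.some_mem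
  have hx₀d : 0 < Metric.infDist x₀ (frontier Ω) := by
    refine (isClosed_frontier.notMem_iff_infDist_pos hfr).1 fun hmem => ?_
    rw [hΩ.isOpen.frontier_eq] at hmem
    exact hmem.2 hx₀
  -- One pair B, τ serves both uses: B dominates c (along a John curve) and 1 + 2A (along a joining
  -- curve), and τ lies below 1/(2c) and 1/(c(1 + A)).
  set B := c + 1 + 2 * A with hB
  set τ := 1 / (2 * (c * (1 + A))) with hτ
  have hτ0 : 0 < τ := by positivity
  have hτc : τ ≤ 1 / (2 * c) := by rw [hτ]; gcongr; nlinarith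
  have hτA : τ ≤ 1 / (c * (1 + A)) := by
    have : 0 < c * (1 + A) := by positivity
    exact one_div_le_one_div_of_le this (by linarith)
  have hτ1 : τ ≤ 1 := hτc.trans (by rw [div_le_one (by positivity)]; linarith)
  -- The three bounds on δ serve the comparison with the integral (4δ ≤ 1/4), the passage of every
  -- John curve through distance δ from ω, and the packing estimate with constant (B + 1) + 2.
  obtain ⟨δ, hδ, hδlt⟩ := exists_between (lt_min (lt_min (show (0 : ℝ) < 1 / 16 by norm_num) hx₀d)
    (show 0 < Metric.diam Ω / (4 * (B + 1 + 2)) by positivity))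
  rw [lt_min_iff, lt_min_iff] at hδlt
  obtain ⟨⟨hδ1, hδx⟩, hδΩ⟩ := hδlt
  rw [lt_div_iff₀ (by positivity)] at hδΩ
  have hδB : 0 ≤ B * δ := by positivity
  obtain ⟨m, C, hm, hC, hosc⟩ := hf.exists_oscillation_bound (δ := δ) hq hσ hM hreg hΩ.isOpen hK
    hfr hdist hδ (by linarith) (by linarith) hτ0 hτ1
  refine measure_mono_null ?_ (hreg.hausdorffGauge_divergence hΩ.isOpen hK
    (B := B + 1) (τ := τ / 2) hδ (by positivity) (by positivity) (by linarith) m hh)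
  refine fun ω hω => ⟨hω.1, ?_⟩
  by_contra hfin
  have hHsum : ∑' k : ℕ, (((k : ENNReal) + 1) * ENNReal.ofReal (gaugeWeight h δ k)) ^
      (1 / (q - 1)) ≠ ⊤ := by
    have hp : 0 < 1 / (q - 1) := one_div_pos.2 (by linarith)
    refine ne_of_eq_of_ne (tsum_congr fun k => ?_)
      (hh.summable_gaugeWeight hp hδ (by linarith) hint).tsum_ofReal_ne_top
    have := hh.gaugeWeight_pos hδ k
    rw [← ENNReal.ofReal_rpow_of_nonneg (by positivity) hp.le,
      ENNReal.ofReal_mul (by positivity), ENNReal.ofReal_add (by positivity) zero_le_one,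
      ENNReal.ofReal_natCast, ENNReal.ofReal_one]
  set ψ : ℕ → ENNReal := fun k => C * (((k : ENNReal) + 1) *
    m (whitneyRegion Ω (B + 1) (τ / 2) (δ * (1 / 2) ^ k) ω)) ^ (1 / q) with hψ
  have hψsum : ∑' k, ψ k ≠ ⊤ := by
    rw [hψ, ENNReal.tsum_mul_left]
    refine ENNReal.mul_ne_top hC (tsum_rpow_ne_top hq _ _ _ (fun k => ?_)
      (fun k => ENNReal.ofReal_ne_top) hfin hHsum)
    simpa using hh.gaugeWeight_pos hδ k
  have hr : ∀ k : ℕ, 0 < δ * (1 / 2 : ℝ) ^ k := fun k => by positivity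
  have hε : 0 < τ / (2 * M * σ) := by positivity
  have hδω : δ ≤ dist x₀ ω := hδx.le.trans (Metric.infDist_le_dist_of_mem hω.1)
  refine hω.2 ⟨fun γ hγ => hγ.exists_tendsto hΩ.isOpen hω.1 hc hδ hδω hε (ψ := ψ) ?_ hψsum,
    fun γ η hγ hη a b ha hb => hγ.limit_unique hη hΩ.isOpen hunif hA hω.1 hc hδ hδω hε (ψ := ψ)
      ?_ (ENNReal.tendsto_atTop_zero_of_tsum_ne_top hψsum) ha hb⟩
  · refine fun k x hx h1 h2 => hosc B k ω x hx (h1.trans ?_) (le_trans ?_ h2)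
    · have := hr k
      gcongr
      linarith
    · have := hr k
      gcongr
  · refine fun k x hx h1 h2 => hosc B k ω x hx (h1.trans ?_) (le_trans ?_ h2)
    · have := hr k
      gcongr
      linarith
    · have := hr k
      gcongr

end Main

end JohnLimits

theorem theorem1p4 (q K c A M : ℝ) (hq : 1 < q) (hK : 1 ≤ K) (hc : 1 ≤ c) (hA : 0 < A)
    (hM : 1 ≤ M) :
    ∃ σ : ℝ, 1 ≤ σ ∧
      ∀ (X₁ : Type u) [MetricSpace X₁] [CompleteSpace X₁] [PathConnectedSpace X₁]
        [MeasurableSpace X₁] [BorelSpace X₁] (ν₁ : Measure X₁) (Ω : Set X₁) (x₀ : X₁)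
        (X₂ : Type v) [MetricSpace X₂] [CompleteSpace X₂] (h : ℝ → ℝ) (f : X₁ → X₂),
        JohnLimits.IsBoundedDomain Ω → Ω ≠ univ →
        JohnLimits.IsAhlforsRegular ν₁ q K Ω →
        (∀ x ∈ Ω, Metric.infDist x (frontier Ω) ≤ M * Metric.infDist x Ωᶜ) →
        JohnLimits.IsUniformDomain A Ω →
        JohnLimits.IsJohnDomain c Ω x₀ →
        JohnLimits.IsDoublingGauge h →
        IntegrableOn (fun t : ℝ => (h t * Real.log (1 / t)) ^ (1 / (q - 1)) / t) (Ioc 0 1) →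
        JohnLimits.ClassA2 ν₁ q Ω σ f →
        JohnLimits.hausdorffGauge h
          {ω ∈ frontier Ω |
            ¬ ((∀ γ : ℝ → X₁, JohnLimits.IsJohnCurve c Ω ω x₀ γ →
                  ∃ a : X₂, Tendsto (fun t => f (γ t)) (𝓝[>] 0) (𝓝 a)) ∧
                (∀ γ η : ℝ → X₁, JohnLimits.IsJohnCurve c Ω ω x₀ γ →
                  JohnLimits.IsJohnCurve c Ω ω x₀ η → ∀ a b : X₂,
                    Tendsto (fun t => f (γ t)) (𝓝[>] 0) (𝓝 a) →
                    Tendsto (fun t => f (η t)) (𝓝[>] 0) (𝓝 b) → a = b))} = 0 := by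
  -- Any σ ≥ 1 would do, because the Whitney balls are shrunk by the factor σ.
  refine ⟨1, le_rfl, ?_⟩
  intro X₁ _ _ _ _ _ ν₁ Ω x₀ X₂ _ _ h f hΩ hΩ' hreg hdist hunif hJohn hh hint hf
  exact hf.limits_along_john_curves hq hK hc hA hM le_rfl hΩ hΩ' hJohn.1 hreg hdist hunif hh hint
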